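/- All Banach rings are commutative and non-Archimedean: a Banach ring is a commutative ring with a complete ultrametric norm for which $|xy|\le C|x||y|$ for some constant $C$. For a Banach ring $R$, $\mathbf{Ban}_R$ is the quasi-abelian category of complete ultrametric Banach $R$-modules (with bounded $R$-action) and bounded $R$-linear maps, and $R\langle X_1,\dots,X_n\rangle$ is the Banach ring of power series whose coefficients tend to $0$, with the maximum norm. The left heart $\mathrm{LH}(\mathbf{Ban}_R)$ is the category of complexes $[0\to E\to F\to 0]$ in $\mathbf{Ban}_R$ with $E\to F$ a monomorphism and $F$ in degree $0$, with commutative squares as morphisms, localized by the squares that are both cartesian and cocartesian; $M\mapsto[0\to 0\to M\to 0]$ embeds $\mathbf{Ban}_R$ into it. For a complex $K$ in $\mathbf{Ban}_R$, $\mathrm{LH}^i(K)=[0\to\mathrm{Coim}\,d^{i-1}\to\mathrm{Ker}\,d^i\to0]$ is the cohomology of $K$ for the left t-structure. Let $A$ be a Banach ring such that * (Tate, with a uniform unit) there is a topologically nilpotent unit $u\in A^\times$ with $\sup_{k\ge0}|u^k|\,|u^{-k}|<\infty$ (for example $|u^k|=|u|^k$ for all $k\in\mathbb Z$); * (strongly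 Noetherian) $A\langle X_1,\dots,X_m\rangle$ is Noetherian for all $m\ge0$. Let $R$ be an affinoid $A$-algebra, i.e. a Banach $A$-algebra that is isomorphic, by an isomorphism of $A$-algebras bounded in both directions, to a quotient $A\langle X_1,\dots,X_m\rangle/I$ with the quotient semi-norm. Let $n\ge0$ and let $f_0,\dots,f_n\in R$ generate the unit ideal of $R$. **Corollary.** The derived rational localization $$R\Big\langle\frac{f_1}{f_0},\dots,\frac{f_n}{f_0}\Big\rangle^h=K_{R\langle X_1,\dots,X_n\rangle}(f_0X_1-f_1,\dots,f_0X_n-f_n)$$ (the Koszul complex, in degrees $-n,\dots,0$, in $\mathbf{Ban}_{R\langle X_1,\dots,X_n\rangle}$) is strictly Koszul regular: $\mathrm{LH}^i$ of it vanishes for all $i\ne0$, and its $\mathrm{LH}^0$ is a Banach module, i.e. is isomorphic in the left heart to an object of $\mathbf{Ban}_{R\langle X_1,\dots,X_n\rangle}$. -/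

import Mathlib

open CategoryTheory CategoryTheory.Limits Filter Topology

universe v u

/-! ### Banach rings -/

/-- A (commutative, non-Archimedean) Banach ring: a commutative ring with a complete ultrametric
norm for which the multiplication is bounded (not necessarily with constant `1`). -/
class BanachRing (R : Type u) extends Norm R, CommRing R, MetricSpace R where
  dist_eq : ∀ x y : R, dist x y = ‖-x + y‖
  norm_add_le_max : ∀ x y : R, ‖x + y‖ ≤ max ‖x‖ ‖y‖
  exists_norm_mul_le : ∃ C : ℝ, ∀ x y : R, ‖x * y‖ ≤ C * ‖x‖ * ‖y‖
  complete : CompleteSpace R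

attribute [instance 10] BanachRing.toCommRing

namespace BanachRing

variable {R : Type u} [BanachRing R]

instance (priority := 100) toNormedAddCommGroup : NormedAddCommGroup R :=
  { ‹BanachRing R› with }

instance (priority := 100) : CompleteSpace R := BanachRing.complete

instance (priority := 100) : IsUltrametricDist R :=
  IsUltrametricDist.isUltrametricDist_of_forall_norm_add_le_max_norm norm_add_le_max

theorem exists_nonneg_norm_mul_le (R : Type u) [BanachRing R] :
    ∃ C : ℝ, 0 ≤ C ∧ ∀ x y : R, ‖x * y‖ ≤ C * ‖x‖ * ‖y‖ := by
  obtain ⟨C, hC⟩ := BanachRing.exists_norm_mul_le (R := R)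
  refine ⟨max C 0, le_max_right _ _, fun x y => (hC x y).trans ?_⟩
  gcongr
  exact le_max_left _ _

end BanachRing

/-- `A` is a Tate ring with a uniform unit: it has a topologically nilpotent unit `u` such that
`‖uᵏ‖ * ‖u⁻ᵏ‖` is bounded for `k : ℕ`.  The bound holds with `C = 1` if `u` is a uniform unit in the
strict sense `‖uᵏ‖ = ‖u‖ ^ k` for all integers `k`; unlike that equality, the boundedness does not
change when the norm is replaced by an equivalent one. -/
def IsTateRingWithUniformUnit (A : Type v) [BanachRing A] : Prop :=
  ∃ u : Aˣ, Tendsto (fun k : ℕ => (u : A) ^ k) atTop (𝓝 0) ∧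
    ∃ C : ℝ, ∀ k : ℕ, ‖((u ^ k : Aˣ) : A)‖ * ‖((u⁻¹ ^ k : Aˣ) : A)‖ ≤ C

/-! ### Tate algebras -/

section TateAlgebra

variable (n : ℕ) (R : Type u) [BanachRing R]

/-- The power series over `R` in `n` variables whose coefficients tend to zero. -/
def tateSubalgebra : Subalgebra R (MvPowerSeries (Fin n) R) where
  carrier := {f | Tendsto (fun m => MvPowerSeries.coeff m f) cofinite (𝓝 0)}
  add_mem' {f g} hf hg := by
    simpa using Tendsto.add hf hg
  mul_mem' {f g} hf hg := by
    classical
    obtain ⟨C, hC0, hC⟩ := BanachRing.exists_nonneg_norm_mul_le R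
    have h1 := Finset.HasAntidiagonal.tendsto_sup'_antidiagonal_cofinite
      (tendsto_mul_cofinite_nhds_zero (tendsto_zero_iff_norm_tendsto_zero.1 hf)
        (tendsto_zero_iff_norm_tendsto_zero.1 hg))
    have h2 := h1.const_mul C
    rw [mul_zero] at h2
    refine squeeze_zero_norm (fun m => ?_) h2
    rw [MvPowerSeries.coeff_mul]
    refine IsUltrametricDist.norm_sum_le_of_forall_le_of_nonempty
      (Finset.HasAntidiagonal.nonempty_antidiagonal m) fun p hp => (hC _ _).trans ?_
    rw [mul_assoc]
    gcongr
    exact Finset.le_sup' (fun i : (Fin n →₀ ℕ) × (Fin n →₀ ℕ) =>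
      ‖MvPowerSeries.coeff i.1 f‖ * ‖MvPowerSeries.coeff i.2 g‖) hp
  algebraMap_mem' r := by
    classical
    refine tendsto_nhds_of_eventually_eq ((Set.finite_singleton (0 : Fin n →₀ ℕ)).subset ?_)
    intro m hm
    by_contra h
    apply hm
    have : (algebraMap R (MvPowerSeries (Fin n) R)) r = MvPowerSeries.C r := rfl
    have h' : m ≠ 0 := h
    simp [this, MvPowerSeries.coeff_C, h']

/-- The Tate algebra `R⟨X₁, …, Xₙ⟩`. -/
def TateAlgebra : Type u := tateSubalgebra n R

namespace TateAlgebra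

noncomputable instance : CommRing (TateAlgebra n R) :=
  inferInstanceAs (CommRing (tateSubalgebra n R))

noncomputable instance : Algebra R (TateAlgebra n R) :=
  inferInstanceAs (Algebra R (tateSubalgebra n R))

variable {n R}

/-- The coefficients of an element of the Tate algebra. -/
noncomputable def coeff (m : Fin n →₀ ℕ) : TateAlgebra n R →ₗ[R] R :=
  (MvPowerSeries.coeff m).comp (tateSubalgebra n R).val.toLinearMap

@[ext]
theorem ext {f g : TateAlgebra n R} (h : ∀ m, coeff m f = coeff m g) : f = g :=
  Subtype.ext (MvPowerSeries.ext h)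

theorem tendsto_coeff (f : TateAlgebra n R) : Tendsto (fun m => coeff m f) cofinite (𝓝 0) :=
  f.2

/-- A family of coefficients that tends to zero defines an element of the Tate algebra. -/
def mk (a : (Fin n →₀ ℕ) → R) (ha : Tendsto a cofinite (𝓝 0)) : TateAlgebra n R :=
  ⟨(a : MvPowerSeries (Fin n) R), ha⟩

theorem coeff_mk (a : (Fin n →₀ ℕ) → R) (ha : Tendsto a cofinite (𝓝 0)) (m : Fin n →₀ ℕ) :
    coeff m (mk a ha) = a m := rfl

theorem coeff_mul (f g : TateAlgebra n R) (m : Fin n →₀ ℕ) :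
    coeff m (f * g) = ∑ p ∈ Finset.HasAntidiagonal.antidiagonal m, coeff p.1 f * coeff p.2 g :=
  MvPowerSeries.coeff_mul _ _ _

/-- The variable `Xᵢ`. -/
noncomputable def X (i : Fin n) : TateAlgebra n R :=
  ⟨MvPowerSeries.X i, by
    classical
    refine tendsto_nhds_of_eventually_eq
      ((Set.finite_singleton (Finsupp.single i 1 : Fin n →₀ ℕ)).subset ?_)
    intro m hm
    by_contra h
    apply hm
    have h' : m ≠ Finsupp.single i 1 := h
    simp [MvPowerSeries.coeff_X, h']⟩

/-- The norm of the Tate algebra: the supremum (in fact maximum) of the norms of the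
coefficients. -/
noncomputable instance : Norm (TateAlgebra n R) := ⟨fun f => ⨆ m, ‖coeff m f‖⟩

theorem norm_def (f : TateAlgebra n R) : ‖f‖ = ⨆ m, ‖coeff m f‖ := rfl

theorem bddAbove (f : TateAlgebra n R) : BddAbove (Set.range fun m => ‖coeff m f‖) :=
  (tendsto_zero_iff_norm_tendsto_zero.1 f.tendsto_coeff).bddAbove_range_of_cofinite

theorem norm_coeff_le (f : TateAlgebra n R) (m : Fin n →₀ ℕ) : ‖coeff m f‖ ≤ ‖f‖ :=
  le_ciSup (bddAbove f) m

theorem norm_le {f : TateAlgebra n R} {B : ℝ} (h : ∀ m, ‖coeff m f‖ ≤ B) : ‖f‖ ≤ B :=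
  ciSup_le h

theorem norm_add_le_max' (f g : TateAlgebra n R) : ‖f + g‖ ≤ max ‖f‖ ‖g‖ :=
  norm_le fun m => by
    rw [map_add]
    exact (BanachRing.norm_add_le_max _ _).trans
      (max_le_max (norm_coeff_le f m) (norm_coeff_le g m))

theorem norm_nonneg' (f : TateAlgebra n R) : 0 ≤ ‖f‖ :=
  (norm_nonneg _).trans (norm_coeff_le f 0)

/-- The norm as a bundled additive group norm. -/
noncomputable def addGroupNorm : AddGroupNorm (TateAlgebra n R) where
  toFun f := ‖f‖
  map_zero' := le_antisymm (norm_le fun m => by simp) (norm_nonneg' 0)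
  add_le' f g := (norm_add_le_max' f g).trans
    (max_le_add_of_nonneg (norm_nonneg' f) (norm_nonneg' g))
  neg' f := by simp [norm_def]
  eq_zero_of_map_eq_zero' f hf := by
    ext m
    have h := norm_coeff_le f m
    have hf' : ‖f‖ = 0 := hf
    rw [hf'] at h
    simpa using h

/-- The Tate algebra as a normed group. -/
@[reducible] noncomputable def normedAddCommGroup : NormedAddCommGroup (TateAlgebra n R) :=
  AddGroupNorm.toNormedAddCommGroup addGroupNorm

noncomputable instance : MetricSpace (TateAlgebra n R) :=
  normedAddCommGroup.toMetricSpace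

theorem dist_def (f g : TateAlgebra n R) : dist f g = ‖-f + g‖ := rfl

theorem completeSpace : CompleteSpace (TateAlgebra n R) := by
  refine Metric.complete_of_cauchySeq_tendsto fun s hs => ?_
  have hd : ∀ (f g : TateAlgebra n R) m, dist (coeff m f) (coeff m g) ≤ dist f g := by
    intro f g m
    rw [dist_def, BanachRing.dist_eq, ← map_neg, ← map_add]
    exact norm_coeff_le _ m
  have hc : ∀ m, CauchySeq fun k => coeff m (s k) := fun m => by
    rw [Metric.cauchySeq_iff] at hs ⊢
    intro ε hε
    obtain ⟨N, hN⟩ := hs ε hε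
    exact ⟨N, fun i hi j hj => (hd _ _ m).trans_lt (hN i hi j hj)⟩
  choose a ha using fun m => cauchySeq_tendsto_of_complete (hc m)
  have key : ∀ ε > 0, ∃ N, ∀ k ≥ N, ∀ m, dist (coeff m (s k)) (a m) ≤ ε := by
    intro ε hε
    obtain ⟨N, hN⟩ := Metric.cauchySeq_iff.1 hs ε hε
    refine ⟨N, fun k hk m => ?_⟩
    refine le_of_tendsto (tendsto_const_nhds.dist (ha m)) ?_
    filter_upwards [eventually_ge_atTop N] with j hj
    exact (hd _ _ m).trans (hN k hk j hj).le
  have ha0 : Tendsto a cofinite (𝓝 0) := by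
    rw [Metric.tendsto_nhds]
    intro ε hε
    obtain ⟨N, hN⟩ := key (ε / 2) (by positivity)
    filter_upwards [Metric.tendsto_nhds.1 (s N).tendsto_coeff (ε / 2) (by positivity)] with m hm
    have h1 := hN N le_rfl m
    have h2 := dist_triangle_left (a m) 0 (coeff m (s N))
    linarith
  refine ⟨mk a ha0, Metric.tendsto_atTop.2 fun ε hε => ?_⟩
  obtain ⟨N, hN⟩ := key (ε / 2) (by positivity)
  refine ⟨N, fun k hk => lt_of_le_of_lt ?_ (half_lt_self hε)⟩
  rw [dist_def]
  refine norm_le fun m => ?_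
  rw [map_add, map_neg, ← BanachRing.dist_eq, coeff_mk]
  exact hN k hk m

/-- The Tate algebra is a Banach ring. -/
noncomputable instance : BanachRing (TateAlgebra n R) where
  dist_eq := dist_def
  norm_add_le_max := norm_add_le_max'
  exists_norm_mul_le := by
    classical
    obtain ⟨C, hC0, hC⟩ := BanachRing.exists_nonneg_norm_mul_le R
    refine ⟨C, fun f g => norm_le fun m => ?_⟩
    rw [coeff_mul]
    refine IsUltrametricDist.norm_sum_le_of_forall_le_of_nonempty
      (Finset.HasAntidiagonal.nonempty_antidiagonal m) fun p hp => (hC _ _).trans ?_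
    gcongr
    · exact mul_nonneg hC0 (norm_nonneg' f)
    · exact norm_coeff_le _ _
    · exact norm_coeff_le _ _
  complete := completeSpace

end TateAlgebra

end TateAlgebra

/-- A Banach ring `A` is strongly Noetherian if all the `A⟨X₁, …, Xₙ⟩` are Noetherian. -/
def IsStronglyNoetherian (A : Type v) [BanachRing A] : Prop :=
  ∀ n : ℕ, IsNoetherianRing (TateAlgebra n A)

/-! ### Affinoid algebras -/

/-- The quotient semi-norm on a quotient of a Banach ring by an ideal. -/
noncomputable def quotientSeminorm {S : Type v} [BanachRing S] (I : Ideal S) (x : S ⧸ I) : ℝ :=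
  ⨅ f : {f : S // Ideal.Quotient.mk I f = x}, ‖(f : S)‖

/-- `R` is an affinoid `A`-algebra: a Banach `A`-algebra that is isomorphic, by an isomorphism of
`A`-algebras that is bounded in both directions, to a quotient `A⟨X₁, …, Xₙ⟩ / I` with the
quotient semi-norm. -/
structure IsAffinoidAlgebra (A : Type v) (R : Type u) [BanachRing A] [BanachRing R]
    [Algebra A R] : Prop where
  algebraMap_bounded : ∃ C : ℝ, ∀ a : A, ‖algebraMap A R a‖ ≤ C * ‖a‖
  exists_presentation : ∃ (n : ℕ) (I : Ideal (TateAlgebra n A))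
    (e : (TateAlgebra n A ⧸ I) ≃ₐ[A] R),
      (∃ C : ℝ, ∀ x, ‖e x‖ ≤ C * quotientSeminorm I x) ∧
      (∃ C : ℝ, ∀ x, quotientSeminorm I x ≤ C * ‖e x‖)

/-! ### The left heart of a quasi-abelian category -/

section LeftHeart

universe w₁ w₂

variable (C : Type w₁) [Category.{w₂} C]

/-- The complexes `[0 → E → F → 0]`, with `F` in degree `0` and `E → F` a monomorphism; the
morphisms are the commutative squares. -/
abbrev MonoComplex : Type max w₁ w₂ :=
  ObjectProperty.FullSubcategory fun X : Arrow C => Mono X.hom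

/-- The squares that are both cartesian and cocartesian. -/
def bicartesianSquares : MorphismProperty (MonoComplex C) := fun X Y f =>
  IsPullback f.hom.left X.obj.hom Y.obj.hom f.hom.right ∧
    IsPushout f.hom.left X.obj.hom Y.obj.hom f.hom.right

/-- The left heart `LH(C)` of the quasi-abelian category `C`: the category of the complexes
`[0 → E → F → 0]` with `E → F` a monomorphism, localized by the bicartesian squares. -/
abbrev LeftHeart : Type max w₁ w₂ := (bicartesianSquares C).Localization

variable {C}

/-- The object of the left heart given by a monomorphism `E → F`. -/
def LeftHeart.of {E F : C} (f : E ⟶ F) [hf : Mono f] : LeftHeart C :=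
  (bicartesianSquares C).Q.obj ⟨Arrow.mk f, hf⟩

open ZeroObject in
/-- The embedding `i : C → LH(C)` on objects: it sends `M` to `[0 → 0 → M → 0]`. -/
noncomputable def LeftHeart.embed [HasZeroMorphisms C] [HasZeroObject C] (M : C) : LeftHeart C :=
  LeftHeart.of (0 : (0 : C) ⟶ M)

end LeftHeart

/-! ### The category of Banach modules -/

/-- A Banach module over the Banach ring `R`: a complete ultrametric normed abelian group with a
bounded `R`-action. -/
structure BanMod (R : Type u) [BanachRing R] where
  carrier : Type u
  [normedAddCommGroup : NormedAddCommGroup carrier]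
  [module : Module R carrier]
  norm_add_le_max : ∀ x y : carrier, ‖x + y‖ ≤ max ‖x‖ ‖y‖
  exists_norm_smul_le : ∃ C : ℝ, ∀ (r : R) (x : carrier), ‖r • x‖ ≤ C * ‖r‖ * ‖x‖
  complete : CompleteSpace carrier

namespace BanMod

variable {R : Type u} [BanachRing R]

instance : CoeSort (BanMod R) (Type u) := ⟨carrier⟩

attribute [instance] normedAddCommGroup module complete

/-- Morphisms of Banach modules: the bounded `R`-linear maps. -/
@[ext]
structure Hom (M N : BanMod R) where
  toLinearMap : M →ₗ[R] N
  exists_bound : ∃ C : ℝ, ∀ x, ‖toLinearMap x‖ ≤ C * ‖x‖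

theorem Hom.exists_nonneg_bound {M N : BanMod R} (f : Hom M N) :
    ∃ C : ℝ, 0 ≤ C ∧ ∀ x, ‖f.toLinearMap x‖ ≤ C * ‖x‖ := by
  obtain ⟨C, hC⟩ := f.exists_bound
  refine ⟨max C 0, le_max_right _ _, fun x => (hC x).trans ?_⟩
  gcongr
  exact le_max_left _ _

instance : Category (BanMod R) where
  Hom := Hom
  id M := ⟨LinearMap.id, 1, fun x => by simp⟩
  comp f g := ⟨g.toLinearMap.comp f.toLinearMap, by
    obtain ⟨C, -, hC⟩ := f.exists_nonneg_bound
    obtain ⟨D, hD0, hD⟩ := g.exists_nonneg_bound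
    refine ⟨D * C, fun x => (hD _).trans ?_⟩
    rw [mul_assoc]
    gcongr
    exact hC x⟩

/-- The linear map underlying a morphism. -/
def lin {M N : BanMod R} (f : M ⟶ N) : M →ₗ[R] N := Hom.toLinearMap f

@[ext]
theorem hom_ext {M N : BanMod R} {f g : M ⟶ N} (h : ∀ x, lin f x = lin g x) : f = g :=
  Hom.ext (LinearMap.ext h)

theorem lin_comp {M N P : BanMod R} (f : M ⟶ N) (g : N ⟶ P) (x : M) :
    lin (f ≫ g) x = lin g (lin f x) := rfl

theorem exists_nonneg_bound {M N : BanMod R} (f : M ⟶ N) :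
    ∃ C : ℝ, 0 ≤ C ∧ ∀ x, ‖lin f x‖ ≤ C * ‖x‖ :=
  Hom.exists_nonneg_bound f

/-- A bounded linear map as a morphism. -/
def ofLin {M N : BanMod R} (f : M →ₗ[R] N) (hf : ∃ C : ℝ, ∀ x, ‖f x‖ ≤ C * ‖x‖) : M ⟶ N :=
  ⟨f, hf⟩

theorem lin_ofLin {M N : BanMod R} (f : M →ₗ[R] N) (hf : ∃ C : ℝ, ∀ x, ‖f x‖ ≤ C * ‖x‖) :
    lin (ofLin f hf) = f := rfl

instance : HasZeroMorphisms (BanMod R) where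
  zero M N := ⟨ofLin 0 ⟨0, fun x => by simp⟩⟩
  comp_zero _ _ := rfl
  zero_comp M {_ _} f := hom_ext fun x => map_zero (lin f)

theorem lin_zero {M N : BanMod R} (x : M) : lin (0 : M ⟶ N) x = 0 := rfl

instance : HasZeroObject (BanMod R) := by
  refine ⟨⟨⟨PUnit, fun x y => by simp, ⟨0, fun r x => by simp⟩, inferInstance⟩, ?_⟩⟩
  rw [IsZero.iff_id_eq_zero]
  exact hom_ext fun x => rfl

theorem mono_of_injective {M N : BanMod R} (f : M ⟶ N) (hf : Function.Injective (lin f)) :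
    Mono f :=
  ⟨fun g h e => hom_ext fun x => hf (by rw [← lin_comp, ← lin_comp, e])⟩

theorem continuous_lin {M N : BanMod R} (f : M ⟶ N) : Continuous (lin f) := by
  obtain ⟨C, -, hC⟩ := exists_nonneg_bound f
  exact AddMonoidHomClass.continuous_of_bound (lin f) C hC

/-- The kernel of a morphism, with the induced norm. -/
def ker {M N : BanMod R} (f : M ⟶ N) : BanMod R where
  carrier := LinearMap.ker (lin f)
  norm_add_le_max x y := M.norm_add_le_max x y
  exists_norm_smul_le := by
    obtain ⟨C, hC⟩ := M.exists_norm_smul_le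
    exact ⟨C, fun r x => hC r x⟩
  complete := (isClosed_singleton.preimage (continuous_lin f)).completeSpace_coe

/-- The coimage of a morphism `M → N`, that is `M / Ker` with the quotient norm. -/
noncomputable def coim {M N : BanMod R} (f : M ⟶ N) : BanMod R :=
  haveI : IsClosed (LinearMap.ker (lin f) : Set M) :=
    isClosed_singleton.preimage (continuous_lin f)
  { carrier := M ⧸ LinearMap.ker (lin f)
    norm_add_le_max := fun x y => by
      refine le_of_forall_pos_le_add fun ε hε => ?_
      obtain ⟨a, rfl, ha⟩ := Submodule.Quotient.norm_mk_lt x hε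
      obtain ⟨b, rfl, hb⟩ := Submodule.Quotient.norm_mk_lt y hε
      rw [← Submodule.Quotient.mk_add]
      refine (Submodule.Quotient.norm_mk_le _ _).trans ((M.norm_add_le_max a b).trans ?_)
      rw [← max_add_add_right]
      exact max_le_max ha.le hb.le
    exists_norm_smul_le := by
      obtain ⟨C, hC⟩ := M.exists_norm_smul_le
      refine ⟨max C 0, fun r x => ?_⟩
      have hD : 0 ≤ max C 0 * ‖r‖ := by positivity
      refine ge_of_tendsto (f := fun ε : ℝ => max C 0 * ‖r‖ * (‖x‖ + ε)) (x := 𝓝[>] 0) ?_ ?_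
      · have : Tendsto (fun ε : ℝ => max C 0 * ‖r‖ * (‖x‖ + ε)) (𝓝 0)
            (𝓝 (max C 0 * ‖r‖ * (‖x‖ + 0))) := by
          exact (Continuous.tendsto (by fun_prop) 0)
        rw [add_zero] at this
        exact this.mono_left nhdsWithin_le_nhds
      · filter_upwards [self_mem_nhdsWithin] with ε hε
        obtain ⟨a, rfl, ha⟩ := Submodule.Quotient.norm_mk_lt x hε
        rw [← Submodule.Quotient.mk_smul]
        refine (Submodule.Quotient.norm_mk_le _ _).trans ((hC r a).trans ?_)
        refine le_trans ?_ (mul_le_mul_of_nonneg_left ha.le hD)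
        gcongr
        exact le_max_left _ _
    complete := inferInstance }

/-- The linear map underlying the canonical morphism `Coim f → Ker g`. -/
def coimToKerLin {M N P : BanMod R} (f : M ⟶ N) (g : N ⟶ P) (h : f ≫ g = 0) :
    (M ⧸ LinearMap.ker (lin f)) →ₗ[R] LinearMap.ker (lin g) :=
  (LinearMap.ker (lin f)).liftQ
    ((lin f).codRestrict (LinearMap.ker (lin g)) fun x => by
      rw [LinearMap.mem_ker, ← lin_comp, h, lin_zero])
    (by rw [LinearMap.ker_codRestrict])

theorem coimToKerLin_mk {M N P : BanMod R} (f : M ⟶ N) (g : N ⟶ P) (h : f ≫ g = 0) (x : M) :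
    (coimToKerLin f g h (Submodule.Quotient.mk x) : N) = lin f x := rfl

theorem coimToKerLin_injective {M N P : BanMod R} (f : M ⟶ N) (g : N ⟶ P) (h : f ≫ g = 0) :
    Function.Injective (coimToKerLin f g h) := by
  refine LinearMap.ker_eq_bot.1 (Submodule.ker_liftQ_eq_bot _ _ _ ?_)
  rw [LinearMap.ker_codRestrict]

theorem coimToKerLin_bounded {M N P : BanMod R} (f : M ⟶ N) (g : N ⟶ P) (h : f ≫ g = 0) :
    ∃ C : ℝ, ∀ x, ‖coimToKerLin f g h x‖ ≤ C * ‖x‖ := by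
  obtain ⟨C, hC0, hC⟩ := exists_nonneg_bound f
  refine ⟨C, fun x => ?_⟩
  refine le_of_forall_pos_le_add fun ε hε => ?_
  obtain ⟨a, rfl, ha⟩ := Submodule.Quotient.norm_mk_lt x
    (show 0 < ε / (C + 1) by positivity)
  have h1 : ‖coimToKerLin f g h (Submodule.Quotient.mk a)‖ = ‖lin f a‖ := rfl
  rw [h1]
  refine (hC a).trans ((mul_le_mul_of_nonneg_left ha.le hC0).trans ?_)
  rw [mul_add]
  gcongr
  rw [mul_div_assoc', div_le_iff₀ (by positivity)]
  nlinarith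

/-- The canonical morphism `Coim f → Ker g` for `f : M → N` and `g : N → P` with `g ∘ f = 0`. -/
noncomputable def coimToKer {M N P : BanMod R} (f : M ⟶ N) (g : N ⟶ P) (h : f ≫ g = 0) :
    coim f ⟶ ker g :=
  ofLin (M := coim f) (N := ker g) (coimToKerLin f g h) (coimToKerLin_bounded f g h)

instance {M N P : BanMod R} (f : M ⟶ N) (g : N ⟶ P) (h : f ≫ g = 0) : Mono (coimToKer f g h) :=
  mono_of_injective _ (coimToKerLin_injective f g h)

/-- The left-heart cohomology `LHⁱ(K) = τ^{≤ i} τ^{≥ i} K` of a complex of Banach modules, that is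
the object `[0 → Coim dⁱ⁻¹ → Ker dⁱ → 0]` of the left heart. -/
noncomputable def leftHeartCohomology (K : CochainComplex (BanMod R) ℤ) (i : ℤ) :
    LeftHeart (BanMod R) :=
  LeftHeart.of (coimToKer (K.d (i - 1) i) (K.d i (i + 1)) (K.d_comp_d _ _ _))

/-! ### Koszul complexes -/

section Koszul

variable {R : Type u} [BanachRing R] {n : ℕ}

/-- The free Banach module on a finite set, with the maximum norm. -/
def free (R : Type u) [BanachRing R] (ι : Type) [Fintype ι] : BanMod R where
  carrier := ι → R
  norm_add_le_max x y := by
    refine (pi_norm_le_iff_of_nonneg (le_max_of_le_left (norm_nonneg _))).2 fun i => ?_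
    exact (BanachRing.norm_add_le_max _ _).trans
      (max_le_max (norm_le_pi_norm x i) (norm_le_pi_norm y i))
  exists_norm_smul_le := by
    obtain ⟨C, hC0, hC⟩ := BanachRing.exists_nonneg_norm_mul_le R
    refine ⟨C, fun r x => (pi_norm_le_iff_of_nonneg (by positivity)).2 fun i => ?_⟩
    refine (hC _ _).trans ?_
    gcongr
    exact norm_le_pi_norm x i
  complete := inferInstance

/-- The index set of the standard basis `e_S` of the term of degree `i` of the Koszul complex on
`n` elements: the subsets `S` of `{1, …, n}` with `-i` elements. -/
abbrev KoszulIndex (n : ℕ) (i : ℤ) : Type := {S : Finset (Fin n) // (S.card : ℤ) = -i}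

/-- Extension by zero of a family on `KoszulIndex n i` to all subsets. -/
def koszulExtend (i : ℤ) : (KoszulIndex n i → R) →ₗ[R] (Finset (Fin n) → R) where
  toFun g S := if h : (S.card : ℤ) = -i then g ⟨S, h⟩ else 0
  map_add' f g := by
    funext S
    by_cases h : (S.card : ℤ) = -i <;> simp [h]
  map_smul' r g := by
    funext S
    by_cases h : (S.card : ℤ) = -i <;> simp [h]

/-- The Koszul differential on families `g` indexed by all subsets: it is the linear map with
`e_S ↦ ∑ k ∈ S, (-1) ^ #{j ∈ S | j < k} • x_k • e_{S ∖ {k}}`, so that the coefficient of the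
result at `e_T` is the following sum over `k ∉ T`. -/
def koszulTotal (x : Fin n → R) : (Finset (Fin n) → R) →ₗ[R] (Finset (Fin n) → R) where
  toFun g T := ∑ k ∈ Tᶜ, (-1) ^ (T.filter (· < k)).card * x k * g (insert k T)
  map_add' f g := by
    funext T
    simp [mul_add, Finset.sum_add_distrib]
  map_smul' r g := by
    funext T
    simp only [Pi.smul_apply, smul_eq_mul, RingHom.id_apply, Finset.mul_sum]
    exact Finset.sum_congr rfl fun k _ => by ring

theorem koszulTotal_comp_self (x : Fin n → R) (g : Finset (Fin n) → R) :
    koszulTotal x (koszulTotal x g) = 0 := by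
  funext T
  have hs : ∀ k l : Fin n, k ∉ T → (-1 : R) ^ ((insert k T).filter (· < l)).card =
      (-1) ^ (T.filter (· < l)).card * (if k < l then -1 else 1) := by
    intro k l hk
    rw [Finset.filter_insert]
    split_ifs with h
    · rw [Finset.card_insert_of_notMem (by simp [hk]), pow_succ]
    · rw [mul_one]
  simp only [koszulTotal, LinearMap.coe_mk, AddHom.coe_mk, Finset.mul_sum, Pi.zero_apply]
  rw [Finset.sum_sigma']
  refine Finset.sum_involution (fun p _ => ⟨p.2, p.1⟩) ?_ ?_ ?_ ?_
  · rintro ⟨k, l⟩ hp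
    simp only [Finset.mem_sigma, Finset.mem_compl, Finset.mem_insert, not_or] at hp
    obtain ⟨hk, hlk, hl⟩ := hp
    simp only
    rw [hs k l hk, hs l k hl, Finset.insert_comm k l]
    rcases lt_or_gt_of_ne hlk with h | h
    · rw [if_neg h.not_gt, if_pos h]
      ring
    · rw [if_pos h, if_neg h.not_gt]
      ring
  · rintro ⟨k, l⟩ hp _ h
    simp only [Finset.mem_sigma, Finset.mem_compl, Finset.mem_insert, not_or] at hp
    simp only [Sigma.mk.injEq] at h
    exact hp.2.1 h.1
  · rintro ⟨k, l⟩ hp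
    simp only [Finset.mem_sigma, Finset.mem_compl, Finset.mem_insert, not_or] at hp ⊢
    exact ⟨hp.2.2, fun h => hp.2.1 h.symm, hp.1⟩
  · rintro ⟨k, l⟩ hp
    rfl

/-- The differential of the Koszul complex as a linear map. -/
def koszulLin (x : Fin n → R) (i j : ℤ) : (KoszulIndex n i → R) →ₗ[R] (KoszulIndex n j → R) :=
  (LinearMap.funLeft R R (Subtype.val : KoszulIndex n j → Finset (Fin n))).comp
    ((koszulTotal x).comp (koszulExtend i))

theorem koszulLin_apply (x : Fin n → R) (i j : ℤ) (g : KoszulIndex n i → R)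
    (T : KoszulIndex n j) :
    koszulLin x i j g T = ∑ k ∈ T.1ᶜ, (-1) ^ (T.1.filter (· < k)).card * x k *
      (if h : ((insert k T.1).card : ℤ) = -i then g ⟨insert k T.1, h⟩ else 0) := rfl

theorem exists_bound_of_free {ι κ : Type} [Fintype ι] [Fintype κ] (f : (ι → R) →ₗ[R] (κ → R)) :
    ∃ C : ℝ, ∀ g, ‖f g‖ ≤ C * ‖g‖ := by
  classical
  obtain ⟨C, hC0, hC⟩ := (free R κ).exists_norm_smul_le.imp fun C hC =>
    (⟨le_max_right C 0, fun r (y : κ → R) => (hC r y).trans (mul_le_mul_of_nonneg_right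
      (mul_le_mul_of_nonneg_right (le_max_left C 0) (norm_nonneg r)) (norm_nonneg y))⟩ :
      0 ≤ max C 0 ∧ ∀ (r : R) (y : κ → R), ‖r • y‖ ≤ max C 0 * ‖r‖ * ‖y‖)
  refine ⟨∑ i, max C 0 * ‖f (fun j => if i = j then 1 else 0)‖, fun g => ?_⟩
  rw [LinearMap.pi_apply_eq_sum_univ f g, Finset.sum_mul]
  refine (norm_sum_le _ _).trans (Finset.sum_le_sum fun i _ => (hC _ _).trans ?_)
  have := mul_le_mul_of_nonneg_left (norm_le_pi_norm g i)
    (mul_nonneg hC0 (norm_nonneg (f (fun j => if i = j then 1 else 0))))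
  linarith

theorem koszulExtend_koszulLin (x : Fin n → R) {i j : ℤ} (hij : i + 1 = j)
    (g : KoszulIndex n i → R) :
    koszulExtend j (koszulLin x i j g) = koszulTotal x (koszulExtend i g) := by
  funext S
  by_cases h : (S.card : ℤ) = -j
  · simp only [koszulExtend, LinearMap.coe_mk, AddHom.coe_mk, dif_pos h]
    rfl
  · simp only [koszulExtend, LinearMap.coe_mk, AddHom.coe_mk, dif_neg h, koszulTotal]
    refine (Finset.sum_eq_zero fun k hk => ?_).symm
    rw [Finset.mem_compl] at hk
    rw [dif_neg, mul_zero]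
    rw [Finset.card_insert_of_notMem hk]
    push_cast
    omega

theorem koszulLin_comp (x : Fin n → R) {i j k : ℤ} (hij : i + 1 = j)
    (g : KoszulIndex n i → R) : koszulLin x j k (koszulLin x i j g) = 0 := by
  funext T
  have h : koszulLin x j k (koszulLin x i j g) T =
    koszulTotal x (koszulExtend j (koszulLin x i j g)) T.1 := rfl
  rw [h, koszulExtend_koszulLin x hij, koszulTotal_comp_self]
  rfl

theorem koszulLin_eq_zero (x : Fin n → R) {i j : ℤ} (hij : i + 1 ≠ j) : koszulLin x i j = 0 := by
  refine LinearMap.ext fun g => funext fun T => ?_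
  rw [koszulLin_apply]
  refine Finset.sum_eq_zero fun k hk => ?_
  rw [Finset.mem_compl] at hk
  rw [dif_neg, mul_zero]
  rw [Finset.card_insert_of_notMem hk]
  have := T.2
  push_cast
  omega

/-- The Koszul complex `K_R(x₁, …, xₙ) = [R → R] ⊗ ⋯ ⊗ [R → R]` of Banach `R`-modules, where the
`k`-th factor is the multiplication by `x_k` placed in degrees `-1` and `0`.  The basis element
`e_S` is the tensor product of the generators in degree `-1` for `k ∈ S` and in degree `0` for
`k ∉ S`; in degree `i` there are the `e_S` with `S` of cardinality `-i`. -/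
noncomputable def koszulComplex (x : Fin n → R) : CochainComplex (BanMod R) ℤ where
  X i := free R (KoszulIndex n i)
  d i j := ofLin (M := free R (KoszulIndex n i)) (N := free R (KoszulIndex n j))
    (koszulLin x i j) (exists_bound_of_free _)
  shape i j h := hom_ext fun g => by
    have h' : koszulLin x i j = 0 := koszulLin_eq_zero x h
    exact congrArg (fun f => f g) h'
  d_comp_d' i j k hij _ := hom_ext fun g => koszulLin_comp x hij g

end Koszul

/-- A (Koszul) complex is regular: its left-heart cohomology vanishes in all degrees different
from `0`. -/
def IsRegular {R : Type u} [BanachRing R] (K : CochainComplex (BanMod R) ℤ) : Prop :=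
  ∀ i : ℤ, i ≠ 0 → IsZero (leftHeartCohomology K i)

/-- A (Koszul) complex is strictly regular: it is regular and its left-heart cohomology in degree
`0` is a Banach module, i.e. isomorphic in the left heart to `[0 → 0 → M → 0]` for a Banach
module `M`. -/
def IsStrictlyRegular {R : Type u} [BanachRing R] (K : CochainComplex (BanMod R) ℤ) : Prop :=
  IsRegular K ∧ ∃ M : BanMod R, Nonempty (leftHeartCohomology K 0 ≅ LeftHeart.embed M)

end BanMod

/-- The derived rational localization `R⟨f₁/f₀, …, fₙ/f₀⟩ʰ` of `R`: the Koszul complex of the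
elements `f₀ X₁ - f₁, …, f₀ Xₙ - fₙ` of `R⟨X₁, …, Xₙ⟩`. -/
noncomputable def derivedRationalLocalization {R : Type u} [BanachRing R] {n : ℕ}
    (f : Fin (n + 1) → R) : CochainComplex (BanMod (TateAlgebra n R)) ℤ :=
  BanMod.koszulComplex fun i : Fin n =>
    algebraMap R (TateAlgebra n R) (f 0) * TateAlgebra.X i -
      algebraMap R (TateAlgebra n R) (f i.succ)

/-! Write `S = R⟨X₁, …, Xₙ⟩`, `a = f₀`, `yᵢ = f₀Xᵢ - fᵢ`. The sequence `y` need not be regular, but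
it is regular up to powers of `a`: for a set `T` of indices and `j ∉ T`, anything killed by `yⱼ`
modulo `I = (yᵢ : i ∈ T)` is killed by a fixed power of `a` (`exists_pow_mul_mem_of_mul_mem`). The
generators of `I` do not involve `Xⱼ`, so modulo `I` one may compare coefficients in `Xⱼ`. If `f = ∑
cₖ Xⱼᵏ` and `b = fⱼ`, then `(aXⱼ - b) f ∈ I` says `b c₀ ≡ 0` and `a cₖ ≡ b cₖ₊₁`. Hence `bᵏ⁺¹ cₖ ≡
0`, by Noetherianity `bᴺ cₖ ≡ 0` with one `N` for all `k`, and so `aᴺ cₖ ≡ bᴺ cₖ₊ₙ ≡ 0` (shifting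
the index by `N`). Since `I` is closed, `aᴺ f ∈ I`.

Induction on the number of elements turns this into: each Koszul cycle in nonzero degree becomes a
boundary after multiplication by a power of `a` (`exists_pow_smul_eq_diff`). The `yᵢ` kill Koszul
homology too, and `a` and the `yᵢ` generate the unit ideal because the `fᵢ` do. So the complex is
algebraically exact in nonzero degrees (`exists_diff_univ_eq`).

The passage to the left heart is functional analysis. `S` is a Tate ring with a uniform unit and is
Noetherian, as a quotient of some `A⟨X₁, …, Xₘ₊ₙ⟩`. The open mapping theorem
(`exists_preimage_norm_le`) makes the bijections `Coim → Ker` isomorphisms, which gives vanishing.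
Submodules of Noetherian Banach modules are closed (`isClosed_submodule`), so in degree `0` the
quotient by the image is a Banach module representing `LH⁰`. -/

/-! ### Uniform units, the open mapping theorem and closed submodules -/

namespace BanachRing

variable {S : Type u} [BanachRing S]

/-- A uniform unit has a bound for `‖uᵏ‖ * ‖u⁻ᵏ‖` over all integers `k`. -/
theorem exists_zpow_bound {u : Sˣ}
    (hu : ∃ C : ℝ, ∀ k : ℕ, ‖((u ^ k : Sˣ) : S)‖ * ‖((u⁻¹ ^ k : Sˣ) : S)‖ ≤ C) :
    ∃ C : ℝ, ∀ k : ℤ, ‖((u ^ k : Sˣ) : S)‖ * ‖((u ^ (-k) : Sˣ) : S)‖ ≤ C := by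
  obtain ⟨C, hC⟩ := hu
  refine ⟨C, fun k => ?_⟩
  obtain ⟨m, rfl | rfl⟩ := Int.eq_nat_or_neg k
  · simpa using hC m
  · have := hC m
    rw [mul_comm] at this
    simpa using this

end BanachRing

namespace BanMod

variable {S : Type u} [BanachRing S]

theorem exists_pos_norm_smul_le (M : BanMod S) :
    ∃ C : ℝ, 0 < C ∧ ∀ (r : S) (x : M), ‖r • x‖ ≤ C * ‖r‖ * ‖x‖ := by
  obtain ⟨C, hC⟩ := M.exists_norm_smul_le
  refine ⟨max C 1, by positivity, fun r x => (hC r x).trans ?_⟩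
  gcongr
  exact le_max_left _ _

instance (M : BanMod S) : IsUltrametricDist M :=
  IsUltrametricDist.isUltrametricDist_of_forall_norm_add_le_max_norm M.norm_add_le_max

/-- Over a ring with a uniform unit, every nonzero vector can be scaled into a given ball by a
unit whose inverse is controlled by the norm of the vector. -/
theorem exists_scaling (hS : IsTateRingWithUniformUnit S) (M : BanMod S) {ε : ℝ} (hε : 0 < ε) :
    ∃ K : ℝ, 0 < K ∧ ∀ y : M, y ≠ 0 → ∃ t : Sˣ,
      ‖(t : S) • y‖ < ε ∧ ‖((t⁻¹ : Sˣ) : S)‖ ≤ K * ‖y‖ := by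
  obtain ⟨u, hu, huC⟩ := hS
  obtain ⟨C, hC⟩ := BanachRing.exists_zpow_bound huC
  obtain ⟨D, hD0, hD⟩ := M.exists_pos_norm_smul_le
  obtain ⟨B, hB0, hB⟩ := BanachRing.exists_nonneg_norm_mul_le S
  have hC0 : 0 ≤ C := (mul_nonneg (norm_nonneg _) (norm_nonneg _)).trans (hC 0)
  -- The summand `1` only makes the constant positive; it is divided by later.
  refine ⟨B * ‖((u⁻¹ : Sˣ) : S)‖ * C * D / ε + 1, by positivity, fun y hy => ?_⟩
  have hy0 : 0 < ‖y‖ := norm_pos_iff.2 hy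
  have hlim : Tendsto (fun k : ℕ => D * ‖(u : S) ^ k‖ * ‖y‖) atTop (𝓝 0) := by
    simpa using ((tendsto_zero_iff_norm_tendsto_zero.1 hu).const_mul D).mul_const ‖y‖
  have hex : ∃ k : ℤ, ‖((u ^ k : Sˣ) : S) • y‖ < ε := by
    obtain ⟨k, hk⟩ := (hlim.eventually (gt_mem_nhds hε)).exists
    exact ⟨k, (hD _ _).trans_lt (by simpa using hk)⟩
  -- Writing `y = uᵐ (u⁻ᵐ y)`, a small `u⁻ᵐ y` with `m` large would make `y` smaller than itself.
  have hbdd : ∃ b : ℤ, ∀ k : ℤ, ‖((u ^ k : Sˣ) : S) • y‖ < ε → b ≤ k := by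
    have hlim' : Tendsto (fun k : ℕ => D * ‖(u : S) ^ k‖ * ε) atTop (𝓝 0) := by
      simpa using ((tendsto_zero_iff_norm_tendsto_zero.1 hu).const_mul D).mul_const ε
    obtain ⟨b, hb⟩ := eventually_atTop.1 (hlim'.eventually (gt_mem_nhds hy0))
    refine ⟨-b, fun k hk => ?_⟩
    by_contra! hlt
    obtain ⟨m, rfl⟩ : ∃ m : ℕ, k = -m := ⟨k.natAbs, by omega⟩
    have h1 := hb m (by omega)
    have h2 : y = ((u ^ m : Sˣ) : S) • (((u ^ (-(m : ℤ)) : Sˣ) : S) • y) := by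
      rw [smul_smul, ← Units.val_mul]
      simp
    have h3 : ‖y‖ ≤ D * ‖(u : S) ^ m‖ * ε := by
      conv_lhs => rw [h2]
      refine (hD _ _).trans ?_
      rw [Units.val_pow_eq_pow_val]
      gcongr
    exact absurd h1 (not_lt.2 h3)
  -- For the least exponent, `uᵏ⁻¹ y` still has norm at least `ε`. This bounds `‖uᵏ⁻¹‖` from below,
  -- and uniformity turns that into an upper bound for the norm of the inverse.
  obtain ⟨k, hk, hmin⟩ := Int.exists_least_of_bdd hbdd hex
  refine ⟨u ^ k, hk, ?_⟩
  have h1 : ε ≤ ‖((u ^ (k - 1) : Sˣ) : S) • y‖ := by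
    by_contra! h
    have := hmin _ h
    omega
  have h2 : ε ≤ D * ‖((u ^ (k - 1) : Sˣ) : S)‖ * ‖y‖ := h1.trans (hD _ _)
  have h3 : ‖(((u ^ k)⁻¹ : Sˣ) : S)‖ ≤ B * ‖((u⁻¹ : Sˣ) : S)‖ * ‖((u ^ (-(k - 1)) : Sˣ) : S)‖ := by
    refine le_trans (le_of_eq ?_) (hB _ _)
    rw [← Units.val_mul]
    congr 2
    group
  have h4 : ‖((u ^ (-(k - 1)) : Sˣ) : S)‖ * ε ≤ C * D * ‖y‖ := by
    calc _ ≤ ‖((u ^ (-(k - 1)) : Sˣ) : S)‖ * (D * ‖((u ^ (k - 1) : Sˣ) : S)‖ * ‖y‖) := by gcongr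
      _ = (‖((u ^ (k - 1) : Sˣ) : S)‖ * ‖((u ^ (-(k - 1)) : Sˣ) : S)‖) * (D * ‖y‖) := by ring
      _ ≤ C * (D * ‖y‖) := by gcongr; exact hC _
      _ = _ := by ring
  calc _ ≤ _ := h3
    _ ≤ B * ‖((u⁻¹ : Sˣ) : S)‖ * (C * D * ‖y‖ / ε) := by
      gcongr
      rwa [le_div_iff₀ hε]
    _ = B * ‖((u⁻¹ : Sˣ) : S)‖ * C * D / ε * ‖y‖ := by ring
    _ ≤ _ := by
      gcongr
      linarith

/-- A morphism of Banach modules that is approximately surjective, with control of the norms, is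
surjective with control of the norms. -/
theorem exists_preimage_of_approx {M N : BanMod S} (f : M ⟶ N) {K : ℝ} (hK : 0 ≤ K)
    (h : ∀ y : N, ∃ x : M, ‖x‖ ≤ K * ‖y‖ ∧ ‖y - lin f x‖ ≤ 1 / 2 * ‖y‖) (y : N) :
    ∃ x : M, lin f x = y ∧ ‖x‖ ≤ 2 * K * ‖y‖ := by
  choose g hg1 hg2 using h
  -- The residue after one approximate lift. Its iterates shrink geometrically, so the successive
  -- lifts sum to an exact one.
  let r : N → N := fun z => z - lin f (g z)
  have hr : ∀ k : ℕ, ‖r^[k] y‖ ≤ (1 / 2) ^ k * ‖y‖ := by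
    intro k
    induction k with
    | zero => simp
    | succ k ih =>
      rw [Function.iterate_succ_apply', pow_succ']
      refine (hg2 _).trans ?_
      rw [mul_assoc]
      gcongr
  let a : ℕ → M := fun k => g (r^[k] y)
  have ha : ∀ k, ‖a k‖ ≤ (1 / 2) ^ k * (K * ‖y‖) := fun k => (hg1 _).trans <| by
    calc K * ‖r^[k] y‖ ≤ K * ((1 / 2) ^ k * ‖y‖) := by gcongr; exact hr k
      _ = _ := by ring
  have hgeom : HasSum (fun k : ℕ => (1 / 2 : ℝ) ^ k * (K * ‖y‖)) (2 * (K * ‖y‖)) :=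
    hasSum_geometric_two.mul_right _
  have hsum : Summable a := Summable.of_norm_bounded hgeom.summable ha
  refine ⟨∑' k, a k, ?_, ?_⟩
  · have hpart : ∀ m, lin f (∑ k ∈ Finset.range m, a k) = y - r^[m] y := by
      intro m
      induction m with
      | zero => simp
      | succ m ih =>
        rw [Finset.sum_range_succ, map_add, ih, Function.iterate_succ_apply']
        simp only [r, a]
        abel
    have h1 : Tendsto (fun m => lin f (∑ k ∈ Finset.range m, a k)) atTop
        (𝓝 (lin f (∑' k, a k))) :=
      ((continuous_lin f).tendsto _).comp hsum.hasSum.tendsto_sum_nat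
    have h2 : Tendsto (fun m => y - r^[m] y) atTop (𝓝 (y - 0)) := by
      refine tendsto_const_nhds.sub (squeeze_zero_norm hr ?_)
      simpa using (tendsto_pow_atTop_nhds_zero_of_lt_one (by norm_num : (0 : ℝ) ≤ 1 / 2)
        (by norm_num)).mul_const ‖y‖
    simp only [hpart] at h1
    simpa using tendsto_nhds_unique h1 h2
  · rw [mul_assoc]
    exact tsum_of_norm_bounded hgeom ha

/-- The open mapping theorem for Banach modules over a Tate ring with a uniform unit. -/
theorem exists_preimage_norm_le (hS : IsTateRingWithUniformUnit S) {M N : BanMod S} (f : M ⟶ N)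
    (hf : Function.Surjective (lin f)) :
    ∃ K : ℝ, 0 ≤ K ∧ ∀ y : N, ∃ x : M, lin f x = y ∧ ‖x‖ ≤ K * ‖y‖ := by
  -- Baire category: the closure of the image of some ball has an interior point.
  have hcover : (⋃ k : ℕ, closure (lin f '' Metric.ball 0 k)) = Set.univ := by
    refine Set.eq_univ_of_forall fun y => ?_
    obtain ⟨x, rfl⟩ := hf y
    obtain ⟨k, hk⟩ := exists_nat_gt ‖x‖
    exact Set.mem_iUnion.2 ⟨k, subset_closure ⟨x, by simpa using hk, rfl⟩⟩
  obtain ⟨k, z, hz⟩ := nonempty_interior_of_iUnion_of_closed (fun _ => isClosed_closure) hcover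
  obtain ⟨ε, hε, hball⟩ := Metric.isOpen_iff.1 isOpen_interior z hz
  have hzmem : z ∈ closure (lin f '' Metric.ball 0 k) := interior_subset hz
  -- Subtracting an approximation of `z` from one of `y + z` moves the ball from `z` to `0`, at the
  -- price of doubling the radius `k`.
  have hdense : ∀ y : N, ‖y‖ < ε → ∀ δ > 0, ∃ x : M, ‖x‖ ≤ 2 * k ∧ ‖y - lin f x‖ ≤ δ := by
    intro y hy δ hδ
    have h1 : y + z ∈ closure (lin f '' Metric.ball 0 k) :=
      interior_subset (hball (by simpa using hy))
    obtain ⟨_, ⟨a, ha, rfl⟩, ha'⟩ := Metric.mem_closure_iff.1 h1 (δ / 2) (by positivity)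
    obtain ⟨_, ⟨b, hb, rfl⟩, hb'⟩ := Metric.mem_closure_iff.1 hzmem (δ / 2) (by positivity)
    rw [mem_ball_zero_iff] at ha hb
    rw [dist_eq_norm] at ha' hb'
    refine ⟨a - b, (norm_sub_le _ _).trans (by linarith), ?_⟩
    calc ‖y - lin f (a - b)‖ = ‖(y + z - lin f a) - (z - lin f b)‖ := by
          rw [map_sub]; congr 1; abel
      _ ≤ _ := norm_sub_le _ _
      _ ≤ δ := by linarith
  obtain ⟨K, hK0, hK⟩ := exists_scaling hS N hε
  obtain ⟨D, hD0, hD⟩ := N.exists_pos_norm_smul_le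
  obtain ⟨B, hB0, hB⟩ := M.exists_pos_norm_smul_le
  refine ⟨2 * (B * K * (2 * k)), by positivity,
    exists_preimage_of_approx f (by positivity) fun y => ?_⟩
  rcases eq_or_ne y 0 with rfl | hy
  · exact ⟨0, by simp⟩
  obtain ⟨t, ht1, ht2⟩ := hK y hy
  -- The precision is chosen so that scaling back by `t⁻¹`, which costs a factor `D * K * ‖y‖`,
  -- leaves an error of at most half of `‖y‖`.
  obtain ⟨x, hx1, hx2⟩ := hdense _ ht1 (1 / (2 * D * K)) (by positivity)
  refine ⟨((t⁻¹ : Sˣ) : S) • x, (hB _ _).trans ?_, ?_⟩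
  · calc _ ≤ B * (K * ‖y‖) * (2 * k) := by gcongr
      _ = _ := by ring
  · have h1 : y - lin f (((t⁻¹ : Sˣ) : S) • x) = ((t⁻¹ : Sˣ) : S) • ((t : S) • y - lin f x) := by
      rw [map_smul, smul_sub, smul_smul, ← Units.val_mul]
      simp
    rw [h1]
    calc _ ≤ _ := hD _ _
      _ ≤ D * (K * ‖y‖) * (1 / (2 * D * K)) := by gcongr
      _ = _ := by field_simp

/-- A closed submodule of a Banach module, with the induced norm. -/
def sub (M : BanMod S) (N : Submodule S M) (hN : IsClosed (N : Set M)) : BanMod S where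
  carrier := N
  norm_add_le_max x y := M.norm_add_le_max x y
  exists_norm_smul_le := by
    obtain ⟨C, hC⟩ := M.exists_norm_smul_le
    exact ⟨C, fun r x => hC r x⟩
  complete := hN.completeSpace_coe

theorem exists_norm_linearCombination_le (M : BanMod S) {ι : Type} [Fintype ι] (v : ι → M) :
    ∃ C : ℝ, ∀ g : ι → S, ‖Fintype.linearCombination S v g‖ ≤ C * ‖g‖ := by
  obtain ⟨C, hC0, hC⟩ := M.exists_pos_norm_smul_le
  refine ⟨∑ i, C * ‖v i‖, fun g => ?_⟩
  rw [Fintype.linearCombination_apply, Finset.sum_mul]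
  refine (norm_sum_le _ _).trans (Finset.sum_le_sum fun i _ => (hC _ _).trans ?_)
  have := mul_le_mul_of_nonneg_left (norm_le_pi_norm g i) (mul_nonneg hC0.le (norm_nonneg (v i)))
  exact le_trans (le_of_eq (by ring)) this

/-- The morphism from a free module given by a finite family of vectors. -/
noncomputable def freeDesc (M : BanMod S) {ι : Type} [Fintype ι] (v : ι → M) : free S ι ⟶ M :=
  ofLin (M := free S ι) (Fintype.linearCombination S v) (exists_norm_linearCombination_le M v)

theorem lin_freeDesc (M : BanMod S) {ι : Type} [Fintype ι] (v : ι → M) (g : ι → S) :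
    lin (freeDesc M v) g = ∑ i, g i • v i := rfl

/-- The submodules of a Noetherian Banach module over a Tate ring with a uniform unit are
closed. -/
theorem isClosed_submodule (hS : IsTateRingWithUniformUnit S) (M : BanMod S) [IsNoetherian S M]
    (N : Submodule S M) : IsClosed (N : Set M) := by
  obtain ⟨C, hC0, hC⟩ := M.exists_pos_norm_smul_le
  have hcont : ∀ c : S, Continuous fun x : M => c • x := fun c =>
    AddMonoidHomClass.continuous_of_bound (DistribSMul.toAddMonoidHom M c) (C * ‖c‖) (hC c)
  let N' : Submodule S M :=
    { N.toAddSubgroup.topologicalClosure with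
      smul_mem' := fun c x hx =>
        map_mem_closure (hcont c) hx fun y hy => N.smul_mem c hy }
  have hN' : IsClosed (N' : Set M) := isClosed_closure
  have hle : N ≤ N' := fun x hx => subset_closure hx
  -- The closure is finitely generated. Its generators will be perturbed into `N`; a small
  -- perturbation of a surjection is still surjective, so `N` is already the closure.
  obtain ⟨r, v, hv⟩ := Submodule.fg_iff_exists_fin_generating_family.1 (IsNoetherian.noetherian N')
  have hvm : ∀ i, v i ∈ N' := fun i => hv ▸ Submodule.subset_span ⟨i, rfl⟩
  let P := M.sub N' hN'
  let w : Fin r → P := fun i => ⟨v i, hvm i⟩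
  have hcoe : ∀ (g : Fin r → S) (z : Fin r → P), ((∑ i, g i • z i : P) : N').1 =
      ∑ i, g i • (z i : N').1 := fun g z => by
    exact (map_sum N'.subtype _ _).trans rfl
  have hsurj : Function.Surjective (lin (freeDesc P w)) := by
    rintro ⟨y, hy⟩
    have hy' := hy
    rw [← hv] at hy'
    obtain ⟨g, rfl⟩ := (Submodule.mem_span_range_iff_exists_fun S).1 hy'
    exact ⟨g, Subtype.ext (hcoe g w)⟩
  obtain ⟨K, hK0, hK⟩ := exists_preimage_norm_le hS _ hsurj
  -- `K + 1` instead of `K` because `K` may be zero. By the ultrametric inequality the number `r` of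
  -- generators does not enter.
  have hε : 0 < 1 / (2 * C * (K + 1)) := by positivity
  have hz : ∀ i, ∃ z : N, ‖v i - z‖ < 1 / (2 * C * (K + 1)) := fun i => by
    obtain ⟨z, hz, hd⟩ := Metric.mem_closure_iff.1 (hvm i) _ hε
    exact ⟨⟨z, hz⟩, by rwa [← dist_eq_norm]⟩
  choose z hz using hz
  let z' : Fin r → P := fun i => ⟨z i, hle (z i).2⟩
  have happrox : ∀ y : P, ∃ x : free S (Fin r), ‖x‖ ≤ K * ‖y‖ ∧
      ‖y - lin (freeDesc P z') x‖ ≤ 1 / 2 * ‖y‖ := by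
    intro y
    obtain ⟨x, rfl, hx⟩ := hK y
    refine ⟨x, hx, ?_⟩
    rw [lin_freeDesc P z' x]
    rw [lin_freeDesc P w x] at hx ⊢
    rw [← Finset.sum_sub_distrib]
    refine IsUltrametricDist.norm_sum_le_of_forall_le_of_nonneg (by positivity) fun i _ => ?_
    rw [← smul_sub]
    refine (hC (x i) (v i - z i)).trans ?_
    have hxi : ‖x i‖ ≤ ‖x‖ := norm_le_pi_norm (show Fin r → S from x) i
    calc _ ≤ C * (K * ‖∑ i, x i • w i‖) * (1 / (2 * C * (K + 1))) := by
          gcongr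
          · exact hxi.trans hx
          · exact (hz i).le
      _ = 1 / 2 * ((K / (K + 1)) * ‖∑ i, x i • w i‖) := by field_simp
      _ ≤ 1 / 2 * (1 * ‖∑ i, x i • w i‖) := by
          gcongr
          rw [div_le_one (by positivity)]
          linarith
      _ = _ := by rw [one_mul]
  have hN'le : N' ≤ N := by
    intro y hy
    obtain ⟨x, hx, -⟩ := exists_preimage_of_approx _ hK0 happrox (⟨y, hy⟩ : N')
    have h1 : y = ∑ i, x i • (z i : M) := by
      rw [← hcoe x z']
      exact congrArg Subtype.val hx.symm
    rw [h1]
    exact Submodule.sum_mem _ fun i _ => N.smul_mem _ (z i).2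
  rwa [le_antisymm hle hN'le]

end BanMod

/-! ### Iterated Tate algebras and the passage from `A` to `R⟨X₁, …, Xₙ⟩` -/

namespace TateAlgebra

section Basic

variable {n : ℕ} {R : Type u} [BanachRing R]

theorem finite_setOf_le_norm_coeff (f : TateAlgebra n R) {ε : ℝ} (hε : 0 < ε) :
    {m | ε ≤ ‖coeff m f‖}.Finite := by
  have h := (tendsto_zero_iff_norm_tendsto_zero.1 f.tendsto_coeff).eventually (gt_mem_nhds hε)
  rw [eventually_cofinite] at h
  simpa only [not_lt] using h

theorem algebraMap_eq (r : R) : algebraMap R (TateAlgebra n R) r = r • 1 :=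
  Algebra.algebraMap_eq_smul_one r

theorem norm_algebraMap_le : ∃ C : ℝ, ∀ r : R, ‖algebraMap R (TateAlgebra n R) r‖ ≤ C * ‖r‖ := by
  obtain ⟨C, hC0, hC⟩ := BanachRing.exists_nonneg_norm_mul_le R
  refine ⟨C * ‖(1 : TateAlgebra n R)‖, fun r => norm_le fun m => ?_⟩
  rw [algebraMap_eq, map_smul, smul_eq_mul]
  refine (hC _ _).trans ?_
  calc _ ≤ C * ‖r‖ * ‖(1 : TateAlgebra n R)‖ := by
        gcongr
        exact norm_coeff_le _ _
    _ = _ := by ring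

end Basic

section Slices

variable {m n : ℕ}

/-- Exponents in `m + n` variables are pairs of exponents in `m` and in `n` variables. -/
noncomputable def splitExponent (m n : ℕ) :
    (Fin (m + n) →₀ ℕ) ≃+ (Fin m →₀ ℕ) × (Fin n →₀ ℕ) :=
  (Finsupp.domCongr finSumFinEquiv.symm).trans Finsupp.sumFinsuppAddEquivProdFinsupp

variable {A : Type v} [BanachRing A]

/-- The coefficient at an exponent of the last `n` variables, as a power series in the first `m`
variables. -/
noncomputable def slice (ν : Fin n →₀ ℕ) (f : TateAlgebra (m + n) A) : TateAlgebra m A :=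
  mk (fun μ => coeff ((splitExponent m n).symm (μ, ν)) f) <|
    f.tendsto_coeff.comp (Function.Injective.tendsto_cofinite fun a b h => by simpa using h)

theorem coeff_slice (ν : Fin n →₀ ℕ) (μ : Fin m →₀ ℕ) (f : TateAlgebra (m + n) A) :
    coeff μ (slice ν f) = coeff ((splitExponent m n).symm (μ, ν)) f := rfl

theorem slice_add (ν : Fin n →₀ ℕ) (f g : TateAlgebra (m + n) A) :
    slice ν (f + g) = slice ν f + slice ν g := by
  ext μ
  simp only [coeff_slice, map_add]

theorem slice_mul (ν : Fin n →₀ ℕ) (f g : TateAlgebra (m + n) A) :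
    slice ν (f * g) = ∑ p ∈ Finset.HasAntidiagonal.antidiagonal ν, slice p.1 f * slice p.2 g := by
  ext μ
  rw [map_sum]
  simp only [coeff_mul, coeff_slice]
  rw [Finset.sum_sigma']
  refine Finset.sum_bij' (fun p _ => ⟨((splitExponent m n p.1).2, (splitExponent m n p.2).2),
      ((splitExponent m n p.1).1, (splitExponent m n p.2).1)⟩)
    (fun q _ => ((splitExponent m n).symm (q.2.1, q.1.1), (splitExponent m n).symm (q.2.2, q.1.2)))
    ?_ ?_ ?_ ?_ ?_
  · rintro ⟨a, b⟩ h
    rw [Finset.HasAntidiagonal.mem_antidiagonal, AddEquiv.eq_symm_apply, map_add] at h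
    simp only [Finset.mem_sigma, Finset.HasAntidiagonal.mem_antidiagonal, ← Prod.fst_add, ← Prod.snd_add, h,
      and_self]
  · rintro ⟨⟨a, b⟩, ⟨c, d⟩⟩ h
    simp only [Finset.mem_sigma, Finset.HasAntidiagonal.mem_antidiagonal] at h
    rw [Finset.HasAntidiagonal.mem_antidiagonal, ← map_add, Prod.mk_add_mk, h.1, h.2]
  · rintro ⟨a, b⟩ h
    simp
  · rintro ⟨⟨a, b⟩, ⟨c, d⟩⟩ h
    simp
  · rintro ⟨a, b⟩ h
    simp

theorem slice_one [DecidableEq (Fin n →₀ ℕ)] (ν : Fin n →₀ ℕ) :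
    slice ν (1 : TateAlgebra (m + n) A) = if ν = 0 then 1 else 0 := by
  classical
  have h1 : ∀ (k : ℕ) (p : Fin k →₀ ℕ),
      coeff p (1 : TateAlgebra k A) = if p = 0 then 1 else 0 := fun k p => MvPowerSeries.coeff_one p
  ext μ
  rw [coeff_slice, h1]
  have h2 : (splitExponent m n).symm (μ, ν) = 0 ↔ μ = 0 ∧ ν = 0 := by
    rw [AddEquiv.map_eq_zero_iff, Prod.mk_eq_zero]
  by_cases hν : ν = 0
  · rw [if_pos hν, h1]
    exact if_congr (h2.trans (and_iff_left hν)) rfl rfl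
  · rw [if_neg hν, if_neg (fun h => hν (h2.1 h).2), map_zero]

theorem tendsto_slice (f : TateAlgebra (m + n) A) :
    Tendsto (fun ν : Fin n →₀ ℕ => slice ν f) cofinite (𝓝 0) := by
  rw [tendsto_zero_iff_norm_tendsto_zero, Metric.tendsto_nhds]
  intro ε hε
  refine ((f.finite_setOf_le_norm_coeff (half_pos hε)).image
    fun p => (splitExponent m n p).2).subset fun ν hν => ?_
  by_contra h
  apply hν
  rw [Set.mem_ofPred_eq, Real.dist_0_eq_abs, abs_norm]
  refine lt_of_le_of_lt (norm_le fun μ => ?_) (half_lt_self hε)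
  by_contra! hlt
  exact h ⟨_, hlt.le, by simp⟩

/-- A family of power series in `m` variables that tends to zero, as a power series in `m + n`
variables. -/
noncomputable def ofSlices (x : (Fin n →₀ ℕ) → TateAlgebra m A) (hx : Tendsto x cofinite (𝓝 0)) :
    TateAlgebra (m + n) A :=
  mk (fun p => coeff (splitExponent m n p).1 (x (splitExponent m n p).2)) <| by
    rw [tendsto_zero_iff_norm_tendsto_zero, Metric.tendsto_nhds] at hx ⊢
    intro ε hε
    have hfin : {ν | ε ≤ ‖x ν‖}.Finite := by
      have := hx ε hε
      rw [eventually_cofinite] at this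
      simpa only [Real.dist_0_eq_abs, abs_norm, not_lt] using this
    -- Large coefficients occur only in the finitely many large `x ν`, each of which has finitely
    -- many.
    have hU := hfin.biUnion fun ν _ => ((x ν).finite_setOf_le_norm_coeff hε).image
      fun μ => (splitExponent m n).symm (μ, ν)
    refine hU.subset fun p hp => ?_
    have hp' : ε ≤ ‖coeff (splitExponent m n p).1 (x (splitExponent m n p).2)‖ := by
      simpa using hp
    refine Set.mem_biUnion (x := (splitExponent m n p).2) (hp'.trans (norm_coeff_le _ _)) ?_
    exact ⟨(splitExponent m n p).1, hp', by simp⟩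

theorem slice_ofSlices (x : (Fin n →₀ ℕ) → TateAlgebra m A) (hx : Tendsto x cofinite (𝓝 0))
    (ν : Fin n →₀ ℕ) : slice ν (ofSlices x hx) = x ν := by
  ext μ
  rw [coeff_slice, ofSlices, coeff_mk]
  simp

variable {R : Type u} [BanachRing R]

/-- A bounded ring homomorphism `A⟨X₁, …, Xₘ⟩ → R` extends to
`A⟨X₁, …, Xₘ, Y₁, …, Yₙ⟩ → R⟨Y₁, …, Yₙ⟩`. -/
noncomputable def mapSlices (n : ℕ) (φ : TateAlgebra m A →+* R) (hφ : Continuous φ) :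
    TateAlgebra (m + n) A →+* TateAlgebra n R where
  toFun f := mk (fun ν => φ (slice ν f)) (by
    simpa [Function.comp_def] using (hφ.tendsto 0).comp f.tendsto_slice)
  map_one' := by
    classical
    ext ν
    rw [coeff_mk, slice_one]
    have h1 : coeff ν (1 : TateAlgebra n R) = if ν = 0 then 1 else 0 := MvPowerSeries.coeff_one ν
    rw [h1]
    split_ifs <;> simp
  map_zero' := by
    ext ν
    have : slice ν (0 : TateAlgebra (m + n) A) = 0 := by
      ext μ
      simp only [coeff_slice, map_zero]
    rw [coeff_mk, this, map_zero, map_zero]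
  map_add' f g := by
    ext ν
    simp only [map_add, coeff_mk, slice_add]
  map_mul' f g := by
    ext ν
    simp only [coeff_mul, coeff_mk, slice_mul, map_sum, map_mul]

/-- Coefficients are lifted one by one. The norm control is what makes the lifts tend to zero again;
surjectivity of `φ` alone would not do. -/
theorem mapSlices_surjective (n : ℕ) (φ : TateAlgebra m A →+* R) (hφ : Continuous φ) {K : ℝ}
    (hK : ∀ y, ∃ x, φ x = y ∧ ‖x‖ ≤ K * ‖y‖) : Function.Surjective (mapSlices n φ hφ) := by
  intro g
  choose s hs1 hs2 using hK
  have hx : Tendsto (fun ν => s (coeff ν g)) cofinite (𝓝 0) := by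
    refine squeeze_zero_norm (fun ν => hs2 _) ?_
    simpa using (tendsto_zero_iff_norm_tendsto_zero.1 g.tendsto_coeff).const_mul K
  refine ⟨ofSlices _ hx, ?_⟩
  ext ν
  change φ (slice ν (ofSlices _ hx)) = _
  rw [slice_ofSlices, hs1]

end Slices

end TateAlgebra

/-- A Tate algebra over an affinoid algebra over a strongly Noetherian ring is Noetherian. -/
theorem IsAffinoidAlgebra.isNoetherianRing_tateAlgebra {A : Type v} {R : Type u} [BanachRing A]
    [BanachRing R] [Algebra A R] (hR : IsAffinoidAlgebra A R) (hA : IsStronglyNoetherian A)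
    (n : ℕ) : IsNoetherianRing (TateAlgebra n R) := by
  obtain ⟨m, I, e, ⟨C, hC⟩, D, hD⟩ := hR.exists_presentation
  let φ : TateAlgebra m A →+* R := (e : (TateAlgebra m A ⧸ I) →+* R).comp (Ideal.Quotient.mk I)
  have hbdd : ∀ x : TateAlgebra m A ⧸ I, BddBelow
      (Set.range fun f : {f : TateAlgebra m A // Ideal.Quotient.mk I f = x} => ‖(f : TateAlgebra m A)‖) :=
    fun x => ⟨0, by rintro _ ⟨f, rfl⟩; exact norm_nonneg _⟩
  have hφ : Continuous φ := by
    refine AddMonoidHomClass.continuous_of_bound φ (max C 0) fun x => (hC _).trans ?_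
    have h0 : 0 ≤ quotientSeminorm I (Ideal.Quotient.mk I x) :=
      Real.iInf_nonneg fun f => norm_nonneg _
    have h1 : quotientSeminorm I (Ideal.Quotient.mk I x) ≤ ‖x‖ :=
      ciInf_le (hbdd _) ⟨x, rfl⟩
    calc _ ≤ max C 0 * quotientSeminorm I (Ideal.Quotient.mk I x) := by
          gcongr
          exact le_max_left _ _
      _ ≤ _ := by gcongr
  -- The quotient semi-norm is an infimum that need not be attained; the larger constant `D + 1`
  -- leaves room when `y ≠ 0`.
  have hK : ∀ y, ∃ x, φ x = y ∧ ‖x‖ ≤ (D + 1) * ‖y‖ := by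
    intro y
    rcases eq_or_ne y 0 with rfl | hy
    · exact ⟨0, by simp⟩
    obtain ⟨x, rfl⟩ := e.surjective y
    have hlt : quotientSeminorm I x < (D + 1) * ‖e x‖ := by
      have := norm_pos_iff.2 hy
      linarith [hD x]
    have : Nonempty {f : TateAlgebra m A // Ideal.Quotient.mk I f = x} :=
      (Ideal.Quotient.mk_surjective x).imp (p := fun f => Ideal.Quotient.mk I f = x)
        (fun a h => h) |>.elim fun a h => ⟨⟨a, h⟩⟩
    obtain ⟨⟨f, hf⟩, hlt'⟩ := exists_lt_of_ciInf_lt hlt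
    exact ⟨f, congrArg e hf, hlt'.le⟩
  have := hA (m + n)
  exact isNoetherianRing_of_surjective _ _ _ (TateAlgebra.mapSlices_surjective n φ hφ hK)

/-- The image of the uniform unit works: bounding `‖uᵏ‖ * ‖u⁻ᵏ‖`, unlike multiplicativity of the
norm on powers of `u`, survives a bounded homomorphism. -/
theorem IsTateRingWithUniformUnit.of_ringHom {A : Type v} {R : Type u} [BanachRing A] [BanachRing R]
    (hA : IsTateRingWithUniformUnit A) (φ : A →+* R) (hφ : ∃ C : ℝ, ∀ a, ‖φ a‖ ≤ C * ‖a‖) :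
    IsTateRingWithUniformUnit R := by
  obtain ⟨u, hu, C, hC⟩ := hA
  obtain ⟨D, hD⟩ := hφ
  have hcont : Continuous φ := AddMonoidHomClass.continuous_of_bound φ D hD
  refine ⟨Units.map φ u, ?_, (max D 0) ^ 2 * C, fun k => ?_⟩
  · have := (hcont.tendsto 0).comp hu
    rw [map_zero] at this
    refine this.congr fun k => ?_
    simp
  · have hD' : ∀ a, ‖φ a‖ ≤ max D 0 * ‖a‖ := fun a => (hD a).trans (by
      gcongr
      exact le_max_left _ _)
    rw [← map_inv, ← map_pow, ← map_pow, Units.coe_map, Units.coe_map]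
    calc _ ≤ (max D 0 * ‖((u ^ k : Aˣ) : A)‖) * (max D 0 * ‖((u⁻¹ ^ k : Aˣ) : A)‖) := by
          gcongr
          · exact hD' _
          · exact hD' _
      _ = (max D 0) ^ 2 * (‖((u ^ k : Aˣ) : A)‖ * ‖((u⁻¹ ^ k : Aˣ) : A)‖) := by ring
      _ ≤ _ := by
          gcongr
          exact hC k

/-! ### Coefficients in one variable and colon ideals -/

namespace TateAlgebra

variable {n : ℕ} {R : Type u} [BanachRing R]

theorem coeff_X_mul (i : Fin n) (f : TateAlgebra n R) (m : Fin n →₀ ℕ) :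
    coeff m (X i * f) = if 1 ≤ m i then coeff (m - Finsupp.single i 1) f else 0 := by
  classical
  have h : coeff m (X i * f) = if Finsupp.single i 1 ≤ m then
      1 * coeff (m - Finsupp.single i 1) f else 0 := MvPowerSeries.coeff_monomial_mul _ _ _ _
  rw [h, one_mul]
  exact if_congr Finsupp.single_le_iff rfl rfl

theorem norm_X_mul_le (i : Fin n) (f : TateAlgebra n R) : ‖X i * f‖ ≤ ‖f‖ := by
  refine norm_le fun m => ?_
  rw [coeff_X_mul]
  split_ifs
  · exact norm_coeff_le _ _
  · simp

theorem norm_X_pow_mul_le (i : Fin n) (f : TateAlgebra n R) (k : ℕ) : ‖X i ^ k * f‖ ≤ ‖f‖ := by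
  induction k with
  | zero => simp
  | succ k ih =>
    rw [pow_succ', mul_assoc]
    exact (norm_X_mul_le _ _).trans ih

/-- The shift of the exponents of one variable: the terms not divisible by `Xⱼ` are dropped and
the other ones are divided by `Xⱼ`. -/
noncomputable def shift (j : Fin n) : TateAlgebra n R →+ TateAlgebra n R where
  toFun f := mk (fun m => coeff (m + Finsupp.single j 1) f) <|
    f.tendsto_coeff.comp (add_left_injective _).tendsto_cofinite
  map_zero' := by
    ext m
    rw [coeff_mk, map_zero, map_zero]
  map_add' f g := by
    ext m
    simp only [map_add, coeff_mk]

theorem coeff_shift (j : Fin n) (f : TateAlgebra n R) (m : Fin n →₀ ℕ) :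
    coeff m (shift j f) = coeff (m + Finsupp.single j 1) f := rfl

theorem coeff_iterate_shift (j : Fin n) (f : TateAlgebra n R) (k : ℕ) (m : Fin n →₀ ℕ) :
    coeff m ((shift j)^[k] f) = coeff (m + Finsupp.single j k) f := by
  induction k generalizing m with
  | zero => simp
  | succ k ih =>
    rw [Function.iterate_succ_apply', coeff_shift, ih, add_assoc, ← Finsupp.single_add, add_comm 1]

theorem shift_X_mul_self (j : Fin n) (f : TateAlgebra n R) : shift j (X j * f) = f := by
  ext m
  rw [coeff_shift, coeff_X_mul, if_pos (by simp), add_tsub_cancel_right]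

theorem shift_X_mul_of_ne {i j : Fin n} (h : i ≠ j) (f : TateAlgebra n R) :
    shift j (X i * f) = X i * shift j f := by
  ext m
  simp only [coeff_shift, coeff_X_mul]
  have h0 : (Finsupp.single j 1 : Fin n →₀ ℕ) i = 0 := by simp [h]
  rw [Finsupp.add_apply, h0, add_zero]
  split_ifs with h1
  · rw [tsub_add_eq_add_tsub (Finsupp.single_le_iff.2 h1)]
  · rfl

theorem shift_algebraMap_mul (j : Fin n) (r : R) (f : TateAlgebra n R) :
    shift j (algebraMap R _ r * f) = algebraMap R _ r * shift j f := by
  ext m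
  simp only [← Algebra.smul_def, coeff_shift, map_smul]

/-- The `k`-th term is the part of `f` of degree at least `k` in `Xⱼ`, and only finitely many
coefficients of `f` are large. -/
theorem tendsto_X_pow_mul_iterate_shift (j : Fin n) (f : TateAlgebra n R) :
    Tendsto (fun k => X j ^ k * (shift j)^[k] f) atTop (𝓝 0) := by
  rw [tendsto_zero_iff_norm_tendsto_zero, Metric.tendsto_atTop]
  intro ε hε
  obtain ⟨N, hN⟩ := ((f.finite_setOf_le_norm_coeff (half_pos hε)).image fun m => m j).bddAbove
  refine ⟨N + 1, fun k hk => ?_⟩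
  rw [Real.dist_0_eq_abs, abs_norm]
  refine lt_of_le_of_lt ((norm_X_pow_mul_le _ _ _).trans (norm_le fun m => ?_)) (half_lt_self hε)
  rw [coeff_iterate_shift]
  by_contra! hlt
  have h1 : m j + k ≤ N := by simpa using hN ⟨_, hlt.le, rfl⟩
  omega

/-- If a closed ideal contains the coefficients of a power series with respect to one variable,
then it contains the power series. -/
theorem mem_of_forall_iterate_shift_sub_mem (j : Fin n) {I : Ideal (TateAlgebra n R)}
    (hI : IsClosed (I : Set (TateAlgebra n R))) {f : TateAlgebra n R}
    (h : ∀ k, (shift j)^[k] f - X j * (shift j)^[k + 1] f ∈ I) : f ∈ I := by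
  -- The partial sums of the expansion of `f` in powers of `Xⱼ`, by telescoping.
  have h1 : ∀ k, f - X j ^ k * (shift j)^[k] f ∈ I := by
    intro k
    induction k with
    | zero => simp
    | succ k ih =>
      have := I.add_mem ih (I.mul_mem_left (X j ^ k) (h k))
      convert this using 1
      ring
  have h2 := (tendsto_const_nhds (x := f)).sub (tendsto_X_pow_mul_iterate_shift j f)
  rw [sub_zero] at h2
  exact hI.mem_of_tendsto h2 (Eventually.of_forall h1)

/-- Modulo a closed ideal that is stable under the shift of `Xⱼ`, the elements killed by
`r₀ Xⱼ - r₁` are killed by a power of `r₀`. -/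
theorem exists_pow_mul_mem_of_mul_mem [IsNoetherianRing (TateAlgebra n R)] (j : Fin n) (r₀ r₁ : R)
    {I : Ideal (TateAlgebra n R)} (hI : IsClosed (I : Set (TateAlgebra n R)))
    (hshift : ∀ f ∈ I, shift j f ∈ I) :
    ∃ N : ℕ, ∀ f, (algebraMap R _ r₀ * X j - algebraMap R _ r₁) * f ∈ I →
      algebraMap R _ r₀ ^ N * f ∈ I := by
  set a : TateAlgebra n R := algebraMap R _ r₀ with ha
  set b : TateAlgebra n R := algebraMap R _ r₁ with hb
  -- The ascending chain of colon ideals `(I : bᵏ)` stabilizes.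
  obtain ⟨N, hN⟩ : ∃ N : ℕ, ∀ (k : ℕ) (f : TateAlgebra n R), b ^ k * f ∈ I → b ^ N * f ∈ I := by
    let c : ℕ →o Submodule (TateAlgebra n R) (TateAlgebra n R) :=
      ⟨fun k => Submodule.comap (LinearMap.mulLeft _ (b ^ k)) I, by
        refine monotone_nat_of_le_succ fun k f hf => ?_
        have hf' : b ^ k * f ∈ I := hf
        have := I.mul_mem_left b hf'
        rw [← mul_assoc, ← pow_succ'] at this
        exact this⟩
    obtain ⟨N, hN⟩ := monotone_stabilizes_iff_noetherian.2 ‹_› c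
    refine ⟨N, fun k f hf => ?_⟩
    have h1 : f ∈ c k := hf
    have h2 : f ∈ c (max N k) := c.monotone (le_max_right _ _) h1
    rw [← hN _ (le_max_left _ _)] at h2
    exact h2
  refine ⟨N, fun f hf => mem_of_forall_iterate_shift_sub_mem j hI ?_⟩
  -- `s` extracts the part free of `Xⱼ`, so `s ((shift j)^[k] f)` is the coefficient of `Xⱼᵏ` in
  -- `f`. Shift-stability of `I` lets both operations descend modulo `I`.
  let s : TateAlgebra n R →+ TateAlgebra n R :=
    AddMonoidHom.id _ - (AddMonoidHom.mulLeft (X j)).comp (shift j)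
  have hs : ∀ g, s g = g - X j * shift j g := fun g => rfl
  have hsI : ∀ g ∈ I, s g ∈ I := fun g hg => I.sub_mem hg (I.mul_mem_left _ (hshift g hg))
  have hsX : ∀ g, s (X j * g) = 0 := fun g => by rw [hs, shift_X_mul_self, sub_self]
  have hsr : ∀ (r : R) g, s (algebraMap R _ r * g) = algebraMap R _ r * s g := fun r g => by
    rw [hs, hs, shift_algebraMap_mul]
    ring
  have hitI : ∀ (k : ℕ), ∀ g ∈ I, (shift j)^[k] g ∈ I := by
    intro k
    induction k with
    | zero => exact fun g hg => hg
    | succ k ih => exact fun g hg => ih _ (hshift g hg)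
  have hit : ∀ (k : ℕ) (r : R) (g : TateAlgebra n R), (shift j)^[k] (algebraMap R _ r * g) =
      algebraMap R _ r * (shift j)^[k] g := by
    intro k r g
    induction k with
    | zero => rfl
    | succ k ih => rw [Function.iterate_succ_apply', ih, shift_algebraMap_mul,
        Function.iterate_succ_apply']
  have hiter_sub : ∀ (k : ℕ) (g g' : TateAlgebra n R), (shift j)^[k] (g - g') = (shift j)^[k] g - (shift j)^[k] g' :=
    fun k => iterate_map_sub (shift j) k
  let c : ℕ → TateAlgebra n R := fun k => s ((shift j)^[k] f)
  have hc0 : b * c 0 ∈ I := by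
    have h1 := hsI _ hf
    rw [sub_mul, mul_assoc, map_sub, ha, hb, hsr, hsX, hsr, mul_zero, zero_sub] at h1
    exact neg_mem_iff.1 h1
  -- This is the coefficient of `Xⱼᵏ⁺¹` in `(a Xⱼ - b) f`.
  have hc : ∀ k, a * c k - b * c (k + 1) ∈ I := by
    intro k
    have h1 := hsI _ (hitI (k + 1) _ hf)
    rw [sub_mul, mul_assoc, hiter_sub, ha, hb, hit, hit, Function.iterate_succ_apply,
      shift_X_mul_self, map_sub, hsr, hsr] at h1
    exact h1
  -- `bᵏ⁺² cₖ₊₁ ≡ a bᵏ⁺¹ cₖ` modulo `I`, starting from `b c₀ ≡ 0`.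
  have hb : ∀ k, b ^ (k + 1) * c k ∈ I := by
    intro k
    induction k with
    | zero => simpa using hc0
    | succ k ih =>
      have h1 := I.sub_mem (I.mul_mem_left a ih) (I.mul_mem_left (b ^ (k + 1)) (hc k))
      convert h1 using 1
      ring
  have hbN : ∀ k, b ^ N * c k ∈ I := fun k => hN _ _ (hb k)
  have ha : ∀ (i k : ℕ), a ^ i * c k - b ^ i * c (k + i) ∈ I := by
    intro i
    induction i with
    | zero => intro k; simp
    | succ i ih =>
      intro k
      have h1 := I.add_mem (I.mul_mem_left a (ih k)) (I.mul_mem_left (b ^ i) (hc (k + i)))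
      convert h1 using 1
      rw [← add_assoc]
      ring
  intro k
  have h1 : a ^ N * c k ∈ I := by
    simpa using I.add_mem (ha N k) (hbN (k + N))
  have h2 : (shift j)^[k] (a ^ N * f) - X j * (shift j)^[k + 1] (a ^ N * f) = a ^ N * c k := by
    have h3 : a ^ N = algebraMap R (TateAlgebra n R) (r₀ ^ N) := (map_pow _ _ _).symm
    rw [h3, hit, hit, Function.iterate_succ_apply']
    simp only [c, hs]
    ring
  rwa [h2]

end TateAlgebra

/-! ### Koszul homology via contraction and exterior multiplication -/

namespace KoszulOperators

variable {R : Type u} [CommRing R] {n : ℕ}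

/-- The sign of the position of `k` relative to `T`. -/
def sign (R : Type u) [CommRing R] (k : Fin n) (T : Finset (Fin n)) : R :=
  (-1) ^ (T.filter (· < k)).card

theorem sign_mul_self (k : Fin n) (T : Finset (Fin n)) : sign R k T * sign R k T = 1 := by
  rw [sign, ← pow_add, ← two_mul, pow_mul]
  simp

theorem sign_insert_self (k : Fin n) (T : Finset (Fin n)) :
    sign R k (insert k T) = sign R k T := by
  simp [sign, Finset.filter_insert]

theorem sign_erase_self (k : Fin n) (T : Finset (Fin n)) :
    sign R k (T.erase k) = sign R k T := by
  simp [sign, Finset.filter_erase]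

theorem sign_insert {k l : Fin n} {T : Finset (Fin n)} (hk : k ∉ T) :
    sign R l (insert k T) = sign R l T * if k < l then -1 else 1 := by
  rw [sign, Finset.filter_insert]
  split_ifs with h
  · rw [Finset.card_insert_of_notMem (by simp [hk]), pow_succ, sign]
  · rw [mul_one, sign]

/-- The contraction with the `k`-th basis vector. -/
def contract (k : Fin n) : (Finset (Fin n) → R) →ₗ[R] (Finset (Fin n) → R) where
  toFun g T := if k ∈ T then 0 else sign R k T * g (insert k T)
  map_add' f g := by
    funext T
    by_cases h : k ∈ T <;> simp [h, mul_add]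
  map_smul' r g := by
    funext T
    by_cases h : k ∈ T <;> simp [h, mul_left_comm]

/-- The exterior multiplication by the `k`-th basis vector. -/
def wedge (k : Fin n) : (Finset (Fin n) → R) →ₗ[R] (Finset (Fin n) → R) where
  toFun g T := if k ∈ T then sign R k T * g (T.erase k) else 0
  map_add' f g := by
    funext T
    by_cases h : k ∈ T <;> simp [h, mul_add]
  map_smul' r g := by
    funext T
    by_cases h : k ∈ T <;> simp [h, mul_left_comm]

theorem contract_apply (k : Fin n) (g : Finset (Fin n) → R) (T : Finset (Fin n)) :
    contract k g T = if k ∈ T then 0 else sign R k T * g (insert k T) := rfl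

theorem wedge_apply (k : Fin n) (g : Finset (Fin n) → R) (T : Finset (Fin n)) :
    wedge k g T = if k ∈ T then sign R k T * g (T.erase k) else 0 := rfl

theorem contract_contract_self (k : Fin n) (g : Finset (Fin n) → R) :
    contract k (contract k g) = 0 := by
  funext T
  simp [contract_apply]

theorem contract_contract {k l : Fin n} (h : k ≠ l) (g : Finset (Fin n) → R) :
    contract k (contract l g) = -contract l (contract k g) := by
  funext T
  simp only [contract_apply, Pi.neg_apply, Finset.mem_insert, h, h.symm, false_or]
  by_cases hk : k ∈ T
  · simp [hk]
  by_cases hl : l ∈ T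
  · simp [hl]
  rw [if_neg hk, if_neg hl, if_neg hl, if_neg hk, sign_insert hk, sign_insert hl,
    Finset.insert_comm k l]
  rcases lt_or_gt_of_ne h with h' | h'
  · rw [if_pos h', if_neg h'.not_gt]
    ring
  · rw [if_neg h'.not_gt, if_pos h']
    ring

/-- The two composites are complementary projections: `contract k ∘ wedge k` keeps the subsets
without `k`, and `wedge k ∘ contract k` those with `k`. -/
theorem contract_wedge_self (k : Fin n) (g : Finset (Fin n) → R) :
    contract k (wedge k g) = g - wedge k (contract k g) := by
  funext T
  simp only [contract_apply, wedge_apply, Pi.sub_apply]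
  by_cases hk : k ∈ T
  · simp [hk, sign_erase_self, ← mul_assoc, sign_mul_self]
  · simp [hk, sign_insert_self, ← mul_assoc, sign_mul_self]

theorem contract_wedge {k l : Fin n} (h : k ≠ l) (g : Finset (Fin n) → R) :
    contract k (wedge l g) = -wedge l (contract k g) := by
  funext T
  simp only [contract_apply, wedge_apply, Pi.neg_apply, Finset.mem_insert, Finset.mem_erase, h,
    h.symm, false_or, ne_eq, not_false_eq_true, true_and]
  by_cases hk : k ∈ T
  · simp [hk]
  by_cases hl : l ∈ T
  · rw [if_neg hk, if_pos hl, if_pos hl, if_neg hk, sign_insert hk,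
      Finset.erase_insert_of_ne h]
    have h1 : sign R k T = sign R k (T.erase l) * if l < k then -1 else 1 := by
      conv_lhs => rw [← Finset.insert_erase hl]
      exact sign_insert (Finset.notMem_erase l T)
    rw [h1]
    rcases lt_or_gt_of_ne h with h' | h'
    · rw [if_pos h', if_neg h'.not_gt]
      ring
    · rw [if_neg h'.not_gt, if_pos h']
      ring
  · simp [hl]

/-- The Koszul differential of the subfamily of `y` indexed by `A`. -/
def diff (y : Fin n → R) (A : Finset (Fin n)) : (Finset (Fin n) → R) →ₗ[R] (Finset (Fin n) → R) :=
  ∑ l ∈ A, y l • contract l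

theorem diff_apply (y : Fin n → R) (A : Finset (Fin n)) (g : Finset (Fin n) → R) :
    diff y A g = ∑ l ∈ A, y l • contract l g := by
  simp [diff]

theorem diff_insert (y : Fin n → R) {A : Finset (Fin n)} {k : Fin n} (hk : k ∉ A)
    (g : Finset (Fin n) → R) : diff y (insert k A) g = diff y A g + y k • contract k g := by
  rw [diff_apply, diff_apply, Finset.sum_insert hk, add_comm]

theorem diff_contract (y : Fin n → R) {A : Finset (Fin n)} {k : Fin n} (hk : k ∉ A)
    (g : Finset (Fin n) → R) : diff y A (contract k g) = -contract k (diff y A g) := by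
  rw [diff_apply, diff_apply, map_sum, ← Finset.sum_neg_distrib]
  refine Finset.sum_congr rfl fun l hl => ?_
  rw [contract_contract (ne_of_mem_of_not_mem hl hk), map_smul, smul_neg]

theorem diff_wedge (y : Fin n → R) {A : Finset (Fin n)} {k : Fin n} (hk : k ∉ A)
    (g : Finset (Fin n) → R) : diff y A (wedge k g) = -wedge k (diff y A g) := by
  rw [diff_apply, diff_apply, map_sum, ← Finset.sum_neg_distrib]
  refine Finset.sum_congr rfl fun l hl => ?_
  rw [contract_wedge (ne_of_mem_of_not_mem hl hk), map_smul, smul_neg]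

/-- Multiplication by `y k` is null-homotopic, with `wedge k` as homotopy; hence `y k` kills Koszul
homology. -/
theorem diff_wedge_of_mem (y : Fin n → R) {A : Finset (Fin n)} {k : Fin n} (hk : k ∈ A)
    (g : Finset (Fin n) → R) : diff y A (wedge k g) = y k • g - wedge k (diff y A g) := by
  rw [← Finset.insert_erase hk, diff_insert y (Finset.notMem_erase k A),
    diff_insert y (Finset.notMem_erase k A), diff_wedge y (Finset.notMem_erase k A),
    contract_wedge_self, map_add, map_smul, smul_sub]
  abel

/-- Contractions with vectors indexed by `A` kill the families that are supported on the subsets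
disjoint from `A`. -/
theorem contract_eq_zero {A : Finset (Fin n)} {k : Fin n} (hk : k ∈ A) {g : Finset (Fin n) → R}
    (hg : ∀ T, ¬ Disjoint T A → g T = 0) : contract k g = 0 := by
  funext T
  rw [contract_apply]
  split_ifs
  · rfl
  · rw [hg _ (Finset.not_disjoint_iff.2 ⟨k, Finset.mem_insert_self _ _, hk⟩), mul_zero]
    rfl

theorem diff_eq_zero (y : Fin n → R) {A : Finset (Fin n)} {g : Finset (Fin n) → R}
    (hg : ∀ T, ¬ Disjoint T A → g T = 0) : diff y A g = 0 := by
  rw [diff_apply]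
  exact Finset.sum_eq_zero fun l hl => by rw [contract_eq_zero hl hg, smul_zero]

theorem diff_apply_mem_span (y : Fin n → R) (A : Finset (Fin n)) (g : Finset (Fin n) → R)
    (T : Finset (Fin n)) : diff y A g T ∈ Ideal.span (y '' A) := by
  rw [diff_apply, Finset.sum_apply]
  exact Ideal.sum_mem _ fun l hl =>
    Ideal.mul_mem_right _ _ (Ideal.subset_span ⟨l, hl, rfl⟩)

/-- Families supported on the subsets disjoint from `A` with values in the ideal of the `y l` for
`l ∈ A` are boundaries. -/
theorem exists_diff_eq (y : Fin n → R) {A : Finset (Fin n)} {g : Finset (Fin n) → R}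
    (hg : ∀ T, ¬ Disjoint T A → g T = 0) (hmem : ∀ T, g T ∈ Ideal.span (y '' A)) :
    ∃ p, diff y A p = g := by
  classical
  have h1 : ∀ T, ∃ c : Fin n → R, ∑ l ∈ A, c l • y l = g T := fun T =>
    Submodule.mem_span_image_finset_iff_exists_fun' R |>.1 (hmem T)
  choose c hc using h1
  -- Cutting the coefficients off outside the subsets disjoint from `A` makes `diff y A` kill `b l`,
  -- so only `y l • b l` remains of the homotopy formula.
  let b : Fin n → Finset (Fin n) → R := fun l T => if Disjoint T A then c T l else 0
  have hb : ∀ l T, ¬ Disjoint T A → b l T = 0 := fun l T h => if_neg h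
  refine ⟨∑ l ∈ A, wedge l (b l), ?_⟩
  rw [map_sum]
  have h2 : ∀ l ∈ A, diff y A (wedge l (b l)) = y l • b l := fun l hl => by
    rw [diff_wedge_of_mem y hl, diff_eq_zero y (hb l), map_zero, sub_zero]
  rw [Finset.sum_congr rfl h2]
  funext T
  rw [Finset.sum_apply]
  by_cases h : Disjoint T A
  · rw [← hc T]
    refine Finset.sum_congr rfl fun l _ => ?_
    simp [b, h, mul_comm]
  · rw [hg T h]
    exact Finset.sum_eq_zero fun l _ => by simp [b, h]

/-- If the successive colon ideals of the family `y` are killed by powers of `a`, then so is the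
Koszul homology in nonzero degrees. -/
theorem exists_pow_smul_eq_diff (y : Fin n → R) (a : R)
    (hcolon : ∀ (A : Finset (Fin n)) (k : Fin n), k ∉ A → ∃ N : ℕ, ∀ b : R,
      y k * b ∈ Ideal.span (y '' A) → a ^ N * b ∈ Ideal.span (y '' A))
    (A : Finset (Fin n)) (g : Finset (Fin n) → R) (hg : diff y A g = 0)
    (hg0 : ∀ T, Disjoint T A → g T = 0) : ∃ (N : ℕ) (h : Finset (Fin n) → R),
      diff y A h = a ^ N • g := by
  classical
  induction A using Finset.induction_on generalizing g with
  | empty =>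
    refine ⟨0, 0, ?_⟩
    have : g = 0 := funext fun T => hg0 T (Finset.disjoint_empty_right T)
    rw [this, map_zero, smul_zero]
  | insert k A hk ih =>
    rw [diff_insert y hk] at hg
    have hz : diff y A (contract k g) = 0 := by
      rw [diff_contract y hk, eq_neg_of_add_eq_zero_left hg, map_neg, map_smul,
        contract_contract_self, smul_zero, neg_zero, neg_zero]
    obtain ⟨N₁, hN₁⟩ := hcolon A k hk
    -- For the differential of `A`, degree zero means `T` disjoint from `A`. There the cycle
    -- equation puts `y k * contract k g T` into the ideal of `A`, so the colon hypothesis makes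
    -- this part of `contract k g` a boundary after scaling by `a ^ N₁`. The induction hypothesis
    -- handles the rest.
    obtain ⟨p, hp⟩ := exists_diff_eq y (A := A)
      (g := fun T => if Disjoint T A then a ^ N₁ * contract k g T else 0)
      (fun T h => if_neg h) (fun T => by
        split_ifs
        · refine hN₁ _ ?_
          have h1 := congrFun hg T
          have h2 : y k * contract k g T = -diff y A g T := by
            rw [eq_neg_iff_add_eq_zero, add_comm]
            exact h1
          rw [h2]
          exact neg_mem (diff_apply_mem_span y A g T)
        · exact zero_mem _)
    have hpp : diff y A (diff y A p) = 0 := by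
      rw [hp]
      exact diff_eq_zero y fun T h => if_neg h
    obtain ⟨N₂, q, hq⟩ := ih (a ^ N₁ • contract k g - diff y A p)
      (by rw [map_sub, map_smul, hz, hpp, smul_zero, sub_zero])
      (fun T hT => by
        rw [hp]
        simp [hT])
    -- Removing the degree-zero part does not change the differential, and makes `y k • r` satisfy
    -- the vanishing condition of the induction hypothesis below.
    let r : Finset (Fin n) → R := fun T => if Disjoint T A then 0 else (q + a ^ N₂ • p) T
    have hr : diff y A r = a ^ (N₂ + N₁) • contract k g := by
      have h1 : r - (q + a ^ N₂ • p) =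
          -fun T => if Disjoint T A then (q + a ^ N₂ • p) T else 0 := by
        funext T
        by_cases h : Disjoint T A <;> simp [r, h]
      have h2 : diff y A (r - (q + a ^ N₂ • p)) = 0 := by
        rw [h1, map_neg, diff_eq_zero y fun T h => if_neg h, neg_zero]
      rw [map_sub, map_add, map_smul, hq, smul_sub, sub_add_cancel, smul_smul, ← pow_add,
        sub_eq_zero] at h2
      exact h2
    set M := N₂ + N₁
    have hcw : ∀ g' : Finset (Fin n) → R, diff y A (contract k (wedge k g')) = contract k (wedge k (diff y A g')) :=
      fun g' => by rw [diff_contract y hk, diff_wedge y hk, map_neg, neg_neg]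
    have hcwc : ∀ g' : Finset (Fin n) → R, contract k (wedge k (contract k g')) = contract k g' := fun g' => by
      rw [contract_wedge_self, contract_contract_self, map_zero, sub_zero]
    -- `a ^ M • g + y k • r` is a cycle for `A`, because `diff y A g = -y k • contract k g`.
    -- Projecting to the subsets without `k` keeps it a cycle and lets `hg0` apply.
    obtain ⟨N₃, s, hs⟩ := ih (contract k (wedge k (a ^ M • g + y k • r)))
      (by
        rw [hcw, map_add, map_smul, map_smul, eq_neg_of_add_eq_zero_left hg, hr, smul_neg,
          smul_comm (y k), neg_add_cancel, map_zero, map_zero])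
      (fun T hT => by
        rw [contract_apply]
        split_ifs with hkT
        · rfl
        have h1 : g T = 0 := hg0 T (Finset.disjoint_insert_right.2 ⟨hkT, hT⟩)
        have h2 : r T = 0 := if_pos hT
        simp [wedge_apply, hkT, h1, h2])
    -- The first term yields the component of `g` without `k` plus an error from `y k • r`; the
    -- second yields the component with `k` and cancels that error.
    refine ⟨N₃ + M, contract k (wedge k s) - a ^ N₃ • wedge k r, ?_⟩
    have h1 : contract k (wedge k g) = g - wedge k (contract k g) := contract_wedge_self k g
    rw [diff_insert y hk, map_sub, map_smul, hcw, hs, map_sub, map_smul, contract_contract_self,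
      diff_wedge y hk, hr, map_smul, map_smul, hcwc]
    simp only [map_add, map_smul, h1, smul_add, smul_sub, smul_neg, zero_sub, smul_smul, pow_add]
    rw [mul_comm (y k)]
    abel

/-- If moreover `a` and the family `y` generate the unit ideal, then the Koszul complex is exact
in nonzero degrees. -/
theorem exists_diff_univ_eq (y : Fin n → R) (a : R)
    (hcolon : ∀ (A : Finset (Fin n)) (k : Fin n), k ∉ A → ∃ N : ℕ, ∀ b : R,
      y k * b ∈ Ideal.span (y '' A) → a ^ N * b ∈ Ideal.span (y '' A))
    (hspan : Ideal.span {a} ⊔ Ideal.span (Set.range y) = ⊤)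
    (g : Finset (Fin n) → R) (hg : diff y Finset.univ g = 0) (hg0 : g ∅ = 0) :
    ∃ h, diff y Finset.univ h = g := by
  obtain ⟨N, h, hN⟩ := exists_pow_smul_eq_diff y a hcolon Finset.univ g hg fun T hT => by
    have : T = ∅ := (Finset.disjoint_iff_inter_eq_empty.1 hT).symm ▸
      (Finset.inter_univ T).symm
    rw [this, hg0]
  -- The ideal of scalars that make `g` a boundary. It contains every `y k` and a power of `a`, so
  -- its radical is everything.
  let J : Ideal R := Submodule.comap (LinearMap.toSpanSingleton R _ g)
    (LinearMap.range (diff y Finset.univ))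
  have ha : a ^ N ∈ J := ⟨h, hN⟩
  have hy : Ideal.span (Set.range y) ≤ J := by
    rw [Ideal.span_le]
    rintro _ ⟨k, rfl⟩
    exact ⟨wedge k g, by
      rw [diff_wedge_of_mem y (Finset.mem_univ k), hg, map_zero, sub_zero]
      rfl⟩
  have hJ : J.radical = ⊤ := by
    rw [eq_top_iff, ← hspan, sup_le_iff, Ideal.span_singleton_le_iff_mem]
    exact ⟨⟨N, ha⟩, hy.trans Ideal.le_radical⟩
  have h1 : (1 : R) ∈ J := (Ideal.eq_top_iff_one _).1 (Ideal.radical_eq_top.1 hJ)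
  obtain ⟨h', hh'⟩ := h1
  exact ⟨h', hh'.trans (one_smul R g)⟩

end KoszulOperators

theorem BanMod.koszulTotal_eq_diff {R : Type u} [BanachRing R] {n : ℕ} (x : Fin n → R)
    (g : Finset (Fin n) → R) :
    koszulTotal x g = KoszulOperators.diff x Finset.univ g := by
  funext T
  rw [KoszulOperators.diff_apply, Finset.sum_apply]
  change ∑ k ∈ Tᶜ, (-1) ^ (T.filter (· < k)).card * x k * g (insert k T) = _
  rw [← Finset.sum_subset (Finset.subset_univ Tᶜ)]
  · refine Finset.sum_congr rfl fun k hk => ?_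
    rw [Pi.smul_apply, KoszulOperators.contract_apply, if_neg (Finset.mem_compl.1 hk),
      KoszulOperators.sign, smul_eq_mul]
    ring
  · intro k _ hk
    rw [Pi.smul_apply, KoszulOperators.contract_apply, if_pos (by simpa using hk), smul_zero]

/-! ### Zero objects and embedded objects in the left heart -/

namespace CategoryTheory.Localization

/-- A localization functor sends zero objects to zero objects. -/
theorem isZero_Q_obj {C : Type*} [Category C] (W : MorphismProperty C) {Z : C} (hZ : IsZero Z) :
    IsZero (W.Q.obj Z) := by
  -- Transformations between this constant functor and the identity extend from `C` to the
  -- localization. As their component at `Z` is the identity, naturality forces every morphism out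
  -- of or into `Z` to be a component.
  let F := (Functor.const W.Localization).obj (W.Q.obj Z)
  have hone : W.Q.map (hZ.to_ Z) = 𝟙 _ := by
    rw [hZ.eq_of_src (hZ.to_ Z) (𝟙 Z), Functor.map_id]
  have hone' : W.Q.map (hZ.from_ Z) = 𝟙 _ := by
    rw [hZ.eq_of_src (hZ.from_ Z) (𝟙 Z), Functor.map_id]
  constructor
  · intro Y
    let α : F ⟶ 𝟭 W.Localization := liftNatTrans W.Q W (W.Q ⋙ F) W.Q F (𝟭 _)
      { app := fun X => W.Q.map (hZ.to_ X)
        naturality := fun X X' f => by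
          change 𝟙 _ ≫ W.Q.map _ = W.Q.map _ ≫ W.Q.map f
          rw [Category.id_comp, ← Functor.map_comp, hZ.eq_of_src (hZ.to_ X ≫ f) (hZ.to_ X')] }
    have hα : α.app (W.Q.obj Z) = 𝟙 (W.Q.obj Z) := by
      simp only [α, liftNatTrans_app, hone]
      simp [F]
    refine ⟨⟨⟨α.app Y⟩, fun φ => ?_⟩⟩
    have h := α.naturality φ
    rw [hα] at h
    simpa [F] using h.symm
  · intro Y
    let β : 𝟭 W.Localization ⟶ F := liftNatTrans W.Q W W.Q (W.Q ⋙ F) (𝟭 _) F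
      { app := fun X => W.Q.map (hZ.from_ X)
        naturality := fun X X' f => by
          change W.Q.map f ≫ W.Q.map _ = W.Q.map _ ≫ 𝟙 _
          rw [Category.comp_id, ← Functor.map_comp, hZ.eq_of_tgt (f ≫ hZ.from_ X') (hZ.from_ X)] }
    have hβ : β.app (W.Q.obj Z) = 𝟙 (W.Q.obj Z) := by
      simp only [β, liftNatTrans_app, hone']
      simp [F]
    refine ⟨⟨⟨β.app Y⟩, fun φ => ?_⟩⟩
    have h := β.naturality φ
    rw [hβ] at h
    simpa [F] using h

end CategoryTheory.Localization

namespace LeftHeart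

variable {C : Type*} [Category C] [HasZeroMorphisms C] [HasZeroObject C]

/-- The square from `f` to `[0 → 0]` is bicartesian, since both of its structure arrows are
isomorphisms. -/
theorem isZero_of_isIso {E F : C} (f : E ⟶ F) [Mono f] [IsIso f] : IsZero (LeftHeart.of f) := by
  open ZeroObject in
  let z : (0 : C) ⟶ 0 := 𝟙 _
  let Z : MonoComplex C := ⟨Arrow.mk z, inferInstanceAs (Mono z)⟩
  have hZ : IsZero Z := by
    constructor
    · intro Y
      exact ⟨⟨⟨⟨Arrow.homMk (0 : (0 : C) ⟶ _) (0 : (0 : C) ⟶ _) (by simp)⟩⟩, fun φ => by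
        ext <;> exact (isZero_zero C).eq_of_src _ _⟩⟩
    · intro Y
      exact ⟨⟨⟨⟨Arrow.homMk (0 : _ ⟶ (0 : C)) (0 : _ ⟶ (0 : C)) (by simp)⟩⟩, fun φ => by
        ext <;> exact (isZero_zero C).eq_of_tgt _ _⟩⟩
  let X : MonoComplex C := ⟨Arrow.mk f, inferInstanceAs (Mono f)⟩
  let φ : X ⟶ Z := hZ.from_ X
  have hφ : bicartesianSquares C φ :=
    have hX : IsIso X.obj.hom := inferInstanceAs (IsIso f)
    have hZ' : IsIso Z.obj.hom := inferInstanceAs (IsIso (𝟙 _))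
    ⟨IsPullback.of_vert_isIso ⟨φ.hom.w⟩, IsPushout.of_vert_isIso ⟨φ.hom.w⟩⟩
  exact (Localization.isZero_Q_obj _ hZ).of_iso
    (Localization.isoOfHom (bicartesianSquares C).Q (bicartesianSquares C) φ hφ)

open ZeroObject in
theorem nonempty_iso_embed {E F M : C} (f : E ⟶ F) [Mono f] (g : F ⟶ M)
    (h₁ : IsPullback f (0 : E ⟶ (0 : C)) g (0 : (0 : C) ⟶ M))
    (h₂ : IsPushout f (0 : E ⟶ (0 : C)) g (0 : (0 : C) ⟶ M)) :
    Nonempty (LeftHeart.of f ≅ LeftHeart.embed M) := by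
  have hm : Mono (0 : (0 : C) ⟶ M) := ⟨fun a b _ => (isZero_zero C).eq_of_tgt _ _⟩
  let X : MonoComplex C := ⟨Arrow.mk f, inferInstanceAs (Mono f)⟩
  let Y : MonoComplex C := ⟨Arrow.mk (0 : (0 : C) ⟶ M), hm⟩
  let φ : X ⟶ Y := ⟨Arrow.homMk (0 : E ⟶ (0 : C)) g h₁.w.symm⟩
  exact ⟨Localization.isoOfHom (bicartesianSquares C).Q (bicartesianSquares C) φ
    ⟨h₁.flip, h₂.flip⟩⟩

end LeftHeart

/-! ### From algebraic exactness to strict regularity -/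

namespace BanMod

variable {S : Type u} [BanachRing S]

/-- The quotient of a Banach module by a closed submodule, with the quotient norm. -/
noncomputable def quot (M : BanMod S) (N : Submodule S M) (hN : IsClosed (N : Set M)) : BanMod S :=
  haveI := hN
  { carrier := M ⧸ N
    norm_add_le_max := fun x y => by
      refine le_of_forall_pos_le_add fun ε hε => ?_
      obtain ⟨a, rfl, ha⟩ := Submodule.Quotient.norm_mk_lt x hε
      obtain ⟨b, rfl, hb⟩ := Submodule.Quotient.norm_mk_lt y hε
      rw [← Submodule.Quotient.mk_add]
      refine (Submodule.Quotient.norm_mk_le _ _).trans ((M.norm_add_le_max a b).trans ?_)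
      rw [← max_add_add_right]
      exact max_le_max ha.le hb.le
    exists_norm_smul_le := by
      obtain ⟨C, hC0, hC⟩ := M.exists_pos_norm_smul_le
      refine ⟨C, fun r x => le_of_forall_pos_le_add fun ε hε => ?_⟩
      obtain ⟨a, rfl, ha⟩ := Submodule.Quotient.norm_mk_lt x
        (show 0 < ε / (C * ‖r‖ + 1) by positivity)
      rw [← Submodule.Quotient.mk_smul]
      refine (Submodule.Quotient.norm_mk_le _ _).trans ((hC r a).trans
        ((mul_le_mul_of_nonneg_left ha.le (by positivity)).trans ?_))
      rw [mul_add]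
      gcongr
      rw [mul_div_assoc', div_le_iff₀ (by positivity)]
      nlinarith
    complete := inferInstance }

/-- The projection to the quotient by a closed submodule. -/
noncomputable def quotMk (M : BanMod S) (N : Submodule S M) (hN : IsClosed (N : Set M)) :
    M ⟶ M.quot N hN :=
  ofLin (N := M.quot N hN) N.mkQ ⟨1, fun x => by
    rw [one_mul]
    exact Submodule.Quotient.norm_mk_le N x⟩

theorem quotMk_surjective (M : BanMod S) (N : Submodule S M) (hN : IsClosed (N : Set M)) :
    Function.Surjective (lin (M.quotMk N hN)) :=
  N.mkQ_surjective

theorem quotMk_eq_zero (M : BanMod S) (N : Submodule S M) (hN : IsClosed (N : Set M)) {x : M} :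
    lin (M.quotMk N hN) x = 0 ↔ x ∈ N :=
  Submodule.Quotient.mk_eq_zero N

/-- The morphism from a quotient induced by a morphism. -/
noncomputable def quotDesc (M : BanMod S) (N : Submodule S M) (hN : IsClosed (N : Set M))
    {P : BanMod S} (f : M ⟶ P) (hf : ∀ x ∈ N, lin f x = 0) : M.quot N hN ⟶ P :=
  ofLin (M := M.quot N hN) (N.liftQ (lin f) hf) (by
    obtain ⟨C, hC0, hC⟩ := exists_nonneg_bound f
    refine ⟨C, fun x => le_of_forall_pos_le_add fun ε hε => ?_⟩
    obtain ⟨a, rfl, ha⟩ := Submodule.Quotient.norm_mk_lt (S := N) x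
      (show 0 < ε / (C + 1) by positivity)
    refine (hC a).trans ((mul_le_mul_of_nonneg_left ha.le hC0).trans ?_)
    rw [mul_add]
    gcongr
    · exact le_rfl
    rw [mul_div_assoc', div_le_iff₀ (by positivity)]
    nlinarith)

theorem quotMk_quotDesc (M : BanMod S) (N : Submodule S M) (hN : IsClosed (N : Set M))
    {P : BanMod S} (f : M ⟶ P) (hf : ∀ x ∈ N, lin f x = 0) :
    M.quotMk N hN ≫ M.quotDesc N hN f hf = f := rfl

/-- An injective morphism with closed range identifies its source with the morphisms into its
target with values in the range. -/
theorem exists_lift (hS : IsTateRingWithUniformUnit S) {E F : BanMod S} (f : E ⟶ F)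
    (hf : Function.Injective (lin f)) (hr : IsClosed (LinearMap.range (lin f) : Set F))
    {P : BanMod S} (g : P ⟶ F) (hg : ∀ x, lin g x ∈ LinearMap.range (lin f)) :
    ∃ l : P ⟶ E, l ≫ f = g := by
  obtain ⟨C, hC⟩ := f.exists_bound
  let f' : E ⟶ F.sub _ hr := ofLin (N := F.sub _ hr) (lin f).rangeRestrict ⟨C, hC⟩
  -- The closed range is itself a Banach module, so the open mapping theorem bounds the inverse of
  -- `f` on it.
  obtain ⟨K, hK0, hK⟩ := exists_preimage_norm_le hS f' (lin f).surjective_rangeRestrict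
  obtain ⟨D, hD0, hD⟩ := exists_nonneg_bound g
  let l : P →ₗ[S] E := (LinearEquiv.ofInjective (lin f) hf).symm.toLinearMap.comp
    ((lin g).codRestrict _ hg)
  have hl : ∀ x, lin f (l x) = lin g x := fun x =>
    congrArg Subtype.val ((LinearEquiv.ofInjective (lin f) hf).apply_symm_apply ⟨lin g x, hg x⟩)
  refine ⟨ofLin l ⟨K * D, fun x => ?_⟩, hom_ext hl⟩
  obtain ⟨e, he, hle⟩ := hK (⟨lin g x, hg x⟩ : LinearMap.range (lin f))
  have h1 : l x = e := hf ((hl x).trans (congrArg Subtype.val he).symm)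
  rw [h1, mul_assoc]
  refine hle.trans ?_
  gcongr
  exact hD x

theorem isIso_of_bijective (hS : IsTateRingWithUniformUnit S) {E F : BanMod S} (f : E ⟶ F)
    (hf : Function.Bijective (lin f)) : IsIso f := by
  have hr : LinearMap.range (lin f) = ⊤ := LinearMap.range_eq_top.2 hf.2
  obtain ⟨l, hl⟩ := exists_lift hS f hf.1 (by rw [hr]; exact isClosed_univ) (𝟙 F)
    (fun x => hr ▸ Submodule.mem_top)
  have := mono_of_injective f hf.1
  exact ⟨l, by rw [← cancel_mono f, Category.assoc, hl, Category.comp_id, Category.id_comp], hl⟩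

open ZeroObject in
/-- The object of the left heart given by an injective morphism with closed range is a Banach
module. -/
theorem exists_nonempty_iso_embed (hS : IsTateRingWithUniformUnit S) {E F : BanMod S} (f : E ⟶ F)
    [Mono f] (hf : Function.Injective (lin f)) (hr : IsClosed (LinearMap.range (lin f) : Set F)) :
    ∃ M : BanMod S, Nonempty (LeftHeart.of f ≅ LeftHeart.embed M) := by
  have hw : f ≫ F.quotMk _ hr = (0 : E ⟶ (0 : BanMod S)) ≫ (0 : (0 : BanMod S) ⟶ _) := by
    rw [zero_comp]
    exact hom_ext fun x => (F.quotMk_eq_zero _ hr).2 ⟨x, rfl⟩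
  have hlift : ∀ s : PullbackCone (F.quotMk _ hr) (0 : (0 : BanMod S) ⟶ _),
      ∃ l : s.pt ⟶ E, l ≫ f = s.fst := fun s => by
    refine exists_lift hS f hf hr s.fst fun x => (F.quotMk_eq_zero _ hr).1 ?_
    rw [← lin_comp, s.condition, comp_zero, lin_zero]
  have hdesc : ∀ (s : PushoutCocone f (0 : E ⟶ (0 : BanMod S))),
      ∀ x ∈ LinearMap.range (lin f), lin s.inl x = 0 := fun s => by
    rintro _ ⟨x, rfl⟩
    rw [← lin_comp, s.condition, zero_comp, lin_zero]
  choose l hl using hlift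
  refine ⟨_, LeftHeart.nonempty_iso_embed f (F.quotMk _ hr)
    ⟨⟨hw⟩, ⟨PullbackCone.IsLimit.mk _ l hl (fun s => (isZero_zero _).eq_of_tgt _ _)
      fun s m hm _ => ?_⟩⟩
    ⟨⟨hw⟩, ⟨PushoutCocone.IsColimit.mk _ (fun s => F.quotDesc _ hr s.inl (hdesc s))
      (fun s => F.quotMk_quotDesc _ hr _ _) (fun s => (isZero_zero _).eq_of_src _ _)
      fun s m hm _ => ?_⟩⟩⟩
  · rw [← cancel_mono f, hm, hl]
  · refine hom_ext fun x => ?_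
    obtain ⟨x, rfl⟩ := F.quotMk_surjective _ hr x
    rw [← lin_comp, ← lin_comp, hm, quotMk_quotDesc]

section Koszul

variable {n : ℕ}

/-- Exactness makes `Coim → Ker` bijective, hence an isomorphism by the open mapping theorem. -/
theorem isZero_leftHeartCohomology_koszulComplex (hS : IsTateRingWithUniformUnit S)
    (x : Fin n → S)
    (hx : ∀ g, koszulTotal x g = 0 → g ∅ = 0 → ∃ h, koszulTotal x h = g) {i : ℤ} (hi : i ≠ 0) :
    IsZero (leftHeartCohomology (koszulComplex x) i) := by
  have : IsIso (coimToKer ((koszulComplex x).d (i - 1) i) ((koszulComplex x).d i (i + 1))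
      ((koszulComplex x).d_comp_d _ _ _)) := by
    refine isIso_of_bijective hS _ ⟨coimToKerLin_injective _ _
      ((koszulComplex x).d_comp_d _ _ _), ?_⟩
    rintro ⟨g, hg⟩
    let g' : KoszulIndex n i → S := g
    have hg' : koszulLin x i (i + 1) g' = 0 := hg
    have h1 : koszulTotal x (koszulExtend i g') = 0 := by
      rw [← koszulExtend_koszulLin x rfl, hg', map_zero]
    have h2 : koszulExtend i g' ∅ = 0 := dif_neg (by simpa using hi)
    obtain ⟨h, hh⟩ := hx _ h1 h2
    -- The differential lowers cardinality by one, so only the component of `h` in degree `i - 1`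
    -- contributes to degree `i`.
    let h' : KoszulIndex n (i - 1) → S := fun T => h T.1
    have h3 : koszulLin x (i - 1) i h' = g' := by
      funext T
      have h4 : koszulTotal x h T.1 = g' T := by
        rw [hh]
        exact dif_pos T.2
      rw [← h4, koszulLin_apply]
      refine Finset.sum_congr rfl fun k hk => ?_
      have h5 : ((insert k T.1).card : ℤ) = -(i - 1) := by
        rw [Finset.card_insert_of_notMem (Finset.mem_compl.1 hk)]
        have := T.2
        push_cast
        omega
      rw [dif_pos h5]
    exact ⟨Submodule.Quotient.mk h', Subtype.ext h3⟩
  exact LeftHeart.isZero_of_isIso _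

/-- In degree `0` what is needed is a closed image of `Coim` in `Ker`, and this is automatic for a
submodule of a Noetherian Banach module. -/
theorem isStrictlyRegular_koszulComplex [IsNoetherianRing S] (hS : IsTateRingWithUniformUnit S)
    (x : Fin n → S)
    (hx : ∀ g, koszulTotal x g = 0 → g ∅ = 0 → ∃ h, koszulTotal x h = g) :
    IsStrictlyRegular (koszulComplex x) := by
  refine ⟨fun i hi => isZero_leftHeartCohomology_koszulComplex hS x hx hi, ?_⟩
  refine exists_nonempty_iso_embed hS
    (coimToKer ((koszulComplex x).d (0 - 1) 0) ((koszulComplex x).d 0 (0 + 1))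
      ((koszulComplex x).d_comp_d _ _ _)) (coimToKerLin_injective _ _
      ((koszulComplex x).d_comp_d _ _ _)) ?_
  have : IsNoetherian S ((koszulComplex x).X 0) :=
    inferInstanceAs (IsNoetherian S (KoszulIndex n 0 → S))
  have : IsNoetherian S (ker ((koszulComplex x).d 0 (0 + 1))) :=
    inferInstanceAs (IsNoetherian S (LinearMap.ker (lin ((koszulComplex x).d 0 (0 + 1)))))
  exact isClosed_submodule hS _ _

end Koszul

end BanMod

/-! ### Closed shift-stable ideals and the conclusion -/

/-- The ideals of a Noetherian Tate ring with a uniform unit are closed. -/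
theorem BanachRing.isClosed_ideal {S : Type u} [BanachRing S] [IsNoetherianRing S]
    (hS : IsTateRingWithUniformUnit S) (I : Ideal S) : IsClosed (I : Set S) := by
  let M : BanMod S :=
    { carrier := S
      norm_add_le_max := BanachRing.norm_add_le_max
      exists_norm_smul_le := BanachRing.exists_norm_mul_le
      complete := inferInstance }
  have : IsNoetherian S M := inferInstanceAs (IsNoetherian S S)
  exact BanMod.isClosed_submodule hS M I

theorem TateAlgebra.shift_mem_span {R : Type u} [BanachRing R] {n : ℕ} {j : Fin n}
    {s : Set (TateAlgebra n R)} (hs : ∀ y ∈ s, ∀ f, shift j (y * f) = y * shift j f) :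
    ∀ f ∈ Ideal.span s, shift j f ∈ Ideal.span s := by
  -- The shift is not linear over the Tate algebra, so the induction needs all multiples of `f` at
  -- once.
  have h : ∀ f ∈ Ideal.span s, ∀ c, shift j (c * f) ∈ Ideal.span s := by
    intro f hf
    refine Submodule.span_induction (fun y hy c => ?_) (fun c => ?_) (fun f g _ _ hf hg c => ?_)
      (fun a f _ hf c => ?_) hf
    · rw [mul_comm, hs y hy]
      exact Ideal.mul_mem_right _ _ (Ideal.subset_span hy)
    · rw [mul_zero, map_zero]
      exact zero_mem _
    · rw [mul_add, map_add]
      exact add_mem (hf c) (hg c)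
    · rw [smul_eq_mul, ← mul_assoc]
      exact hf _
  exact fun f hf => by simpa using h f hf 1

theorem mainTheorem5 {A : Type v} {R : Type u} [BanachRing A] [BanachRing R] [Algebra A R]
    (hTate : IsTateRingWithUniformUnit A) (hNoeth : IsStronglyNoetherian A) (hR : IsAffinoidAlgebra A R)
    {n : ℕ} (f : Fin (n + 1) → R) (hf : Ideal.span (Set.range f) = ⊤) :
    BanMod.IsStrictlyRegular (derivedRationalLocalization f) := by
  have hS : IsTateRingWithUniformUnit (TateAlgebra n R) :=
    (hTate.of_ringHom (algebraMap A R) hR.algebraMap_bounded).of_ringHom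
      (algebraMap R (TateAlgebra n R)) TateAlgebra.norm_algebraMap_le
  have : IsNoetherianRing (TateAlgebra n R) := hR.isNoetherianRing_tateAlgebra hNoeth n
  refine BanMod.isStrictlyRegular_koszulComplex hS _ fun g hg hg0 => ?_
  simp only [BanMod.koszulTotal_eq_diff] at hg ⊢
  refine KoszulOperators.exists_diff_univ_eq _ (algebraMap R (TateAlgebra n R) (f 0))
    (fun T j hj => ?_) ?_ g hg hg0
  · refine TateAlgebra.exists_pow_mul_mem_of_mul_mem j _ _ (BanachRing.isClosed_ideal hS _)
      (TateAlgebra.shift_mem_span ?_)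
    rintro _ ⟨i, hi, rfl⟩ a
    -- The generators with index in `T` do not involve `Xⱼ`, so the shift commutes with them.
    have hij : i ≠ j := ne_of_mem_of_not_mem hi hj
    simp only [sub_mul, mul_assoc, map_sub, TateAlgebra.shift_algebraMap_mul,
      TateAlgebra.shift_X_mul_of_ne hij]
  · rw [eq_top_iff, ← Ideal.map_top (algebraMap R (TateAlgebra n R)), ← hf, Ideal.map_span,
      Ideal.span_le]
    rintro _ ⟨_, ⟨k, rfl⟩, rfl⟩
    have h0 : algebraMap R (TateAlgebra n R) (f 0) ∈
        Ideal.span {algebraMap R (TateAlgebra n R) (f 0)} := Ideal.mem_span_singleton_self _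
    refine Fin.cases (Ideal.mem_sup_left h0) (fun i => ?_) k
    -- `fᵢ = f₀Xᵢ - (f₀Xᵢ - fᵢ)`.
    have h1 := Ideal.sub_mem _ (Ideal.mem_sup_left (Ideal.mul_mem_right (TateAlgebra.X i) _ h0))
      (Ideal.mem_sup_right (Ideal.subset_span (Set.mem_range_self
        (f := fun i : Fin n => algebraMap R (TateAlgebra n R) (f 0) * TateAlgebra.X i -
          algebraMap R (TateAlgebra n R) (f i.succ)) i)))
    rw [sub_sub_cancel] at h1
    exact h1
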